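/- **Setting.** Let $n\ge 2$ agents, with convex costs $f_1,\dots,f_n$, solve $$\min_{x\in\mathcal X} f(x):=\frac1n\sum_{i=1}^n f_i(x),\qquad \mathcal X=\{x\in\mathbb R^d: g_k(x)\le 0,\ k=1,\dots,m\},$$ where $\mathcal X$ is non-empty, convex and compact, $R>0$ is the smallest radius with $\mathcal X\subseteq B(R):=\{x:\|x\|_2\le R\}$, and there is $x\in\mathrm{relint}(\mathcal X)$ with $g_k(x)<0$ for all $k$. The functions $f_i$, $g_k$ are convex on $B(R)$, and for $x\in B(R)$ the agents use sub-gradients $\nabla f_i(x)\in\partial f_i(x)$, $\nabla g_k(x)\in\partial g_k(x)$ (sub-gradients of the functions restricted to $B(R)$ suffice) with $\|\nabla f_i(x)\|\le L$ and $\|\nabla g_k(x)\|\le L$. The agents are the nodes of a connected undirected graph; $W\in\mathbb R^{n\times n}$ is doubly stochastic with non-negative entries, $W_{ij}>0$ if $i$ and $j$ are adjacent and $W_{ij}=0$ if $i\neq j$ are not adjacent. Its second largest singular value satisfies $\sigma_2(W)<1$. Let $x_*\in\mathcal X$ be a minimizer of $f$ over $\mathcal X$, and let $\eta>0$. **Algorithm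 (distributed stochastic primal-dual method).** With step sizes $\alpha(t)$, start from $x_i(0)=0$, $\lambda_i(0)=0\in\mathbb R^m_+$. At times $t=0,1,2,\dots$ each agent $i$ draws $K_i(t)\in\{1,\dots,m\}$ whose conditional law, given all the indices drawn by all the agents at times $s<t$, is $\mathbb P[K_i(t)=k]=\lambda_{i,k}(t)/\|\lambda_i(t)\|_1$ (uniform if $\lambda_i(t)=0$), and, with $g=(g_1,\dots,g_m)$, $$y_i(t)=x_i(t)-\alpha(t)\big(\nabla f_i(x_i(t))+\|\lambda_i(t)\|_1\nabla g_{K_i(t)}(x_i(t))\big),\qquad \gamma_i(t)=\lambda_i(t)+\alpha(t)\big(g(x_i(t))-\eta\lambda_i(t)\big),$$ $$x_i(t+1)=\Pi_{B(R)}\Big(\sum_{j=1}^n W_{ij}y_j(t)\Big),\qquad \lambda_i(t+1)=\Pi_{\mathbb R^m_+}\Big(\sum_{j=1}^n W_{ij}\gamma_j(t)\Big),$$ where $\Pi$ is Euclidean projection. The estimate of agent $i$ after $T$ iterations is $\hat x_i(T)=\sum_{t=0}^{T-1}\alpha(t)x_i(t)\big/\sum_{t=0}^{T-1}\alpha(t)$.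 **Theorem.** Use the step size $\alpha(t)=R/\sqrt{t+1}$ and suppose $\eta\alpha(t)\le\frac12$ for all $t$. Put $$C=1+\tfrac52 mL^2R^2+20L^2\Big(1+\frac{nm^{3/2}LR}{\eta}\Big)^2\Big(\frac{\log(T\sqrt{nT})}{1-\sigma_2(W)}\Big)^{3/2}.$$ Then for every integer $T\ge2$: (i) with probability at least $1-\frac1T$, simultaneously for all agents $i$, $$f(\hat x_i(T))-f(x_*)\le\frac{\log T}{\sqrt T-1}\Big(RC+\frac{4\sqrt{10}\,n\,m^2L^2R^3}{\eta}\Big);$$ (ii) for every agent $i$, $f(\hat x_i(T))-f(x_*)$ is integrable and $$\mathbb E\big[f(\hat x_i(T))-f(x_*)\big]\le\frac{RC\log T}{\sqrt T-1}.$$ -/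

import Mathlib

open MeasureTheory ProbabilityTheory

noncomputable section

namespace DistPD

/-- Data of the distributed problem: the agents' costs `f i`, the constraint functions `g k`, the
sub-gradients used by the agents, the communication graph, the weight matrix, the radius `R` of the
ball, the Lipschitz constant `L` and the regularization parameter `η`. -/
structure Problem (d n m : ℕ) where
  f : Fin n → EuclideanSpace ℝ (Fin d) → ℝ
  g : Fin m → EuclideanSpace ℝ (Fin d) → ℝ
  gradf : Fin n → EuclideanSpace ℝ (Fin d) → EuclideanSpace ℝ (Fin d)
  gradg : Fin m → EuclideanSpace ℝ (Fin d) → EuclideanSpace ℝ (Fin d)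
  G : SimpleGraph (Fin n)
  W : Matrix (Fin n) (Fin n) ℝ
  R : ℝ
  L : ℝ
  η : ℝ

/-- `v` is a sub-gradient at `x` of the function `h` with domain `s`. -/
def IsSubgradient {d : ℕ} (s : Set (EuclideanSpace ℝ (Fin d)))
    (h : EuclideanSpace ℝ (Fin d) → ℝ) (x v : EuclideanSpace ℝ (Fin d)) : Prop :=
  ∀ y ∈ s, h x + inner ℝ v (y - x) ≤ h y

/-- Euclidean projection onto the closed ball of radius `R` centred at the origin. -/
def projBall {d : ℕ} (R : ℝ) (v : EuclideanSpace ℝ (Fin d)) : EuclideanSpace ℝ (Fin d) :=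
  (R / max R ‖v‖) • v

/-- The law on `{1, …, m}` proportional to the multipliers `lam`; uniform if they all vanish. -/
def samplingProb {m : ℕ} (lam : Fin m → ℝ) (k : Fin m) : ℝ :=
  open scoped Classical in
  if lam = 0 then 1 / (m : ℝ) else lam k / ∑ l, |lam l|

/-- The primal and dual variables of all the agents. -/
structure State (d n m : ℕ) where
  x : Fin n → EuclideanSpace ℝ (Fin d)
  lam : Fin n → Fin m → ℝ

/-- The information at time `t`: the `σ`-algebra generated by the indices drawn by all the agents
before time `t`. The variables `x_i(s)`, `λ_i(s)` with `s ≤ t` are functions of these indices. -/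
abbrev history {n m : ℕ} {Ω : Type*} (K : ℕ → Fin n → Ω → Fin m) (t : ℕ) : MeasurableSpace Ω :=
  ⨆ (s : ℕ) (_ : s < t) (j : Fin n), MeasurableSpace.comap (K s j) inferInstance

namespace Problem

variable {d n m : ℕ} (P : Problem d n m)

/-- The feasible set. -/
def feasible : Set (EuclideanSpace ℝ (Fin d)) := {x | ∀ k, P.g k x ≤ 0}

/-- The cumulative cost, i.e. the average of the agents' costs. -/
def cost (x : EuclideanSpace ℝ (Fin d)) : ℝ := (1 / (n : ℝ)) * ∑ i, P.f i x

/-- The closed Euclidean ball of radius `R` centred at the origin. -/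
def ball : Set (EuclideanSpace ℝ (Fin d)) := Metric.closedBall 0 P.R

/-- The second largest singular value of the weight matrix (Mathlib counts from `0`). -/
def sigma2 : ℝ := (Matrix.toEuclideanLin P.W).singularValues 1

/-- The standing assumptions on the feasible set, the functions and the network. -/
structure Standing : Prop where
  feasible_nonempty : P.feasible.Nonempty
  feasible_convex : Convex ℝ P.feasible
  feasible_compact : IsCompact P.feasible
  radius_pos : 0 < P.R
  radius_least : IsLeast {r : ℝ | 0 ≤ r ∧ P.feasible ⊆ Metric.closedBall 0 r} P.R
  slater : ∃ x ∈ intrinsicInterior ℝ P.feasible, ∀ k, P.g k x < 0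
  f_convex : ∀ i, ConvexOn ℝ P.ball (P.f i)
  g_convex : ∀ k, ConvexOn ℝ P.ball (P.g k)
  gradf_mem : ∀ i, ∀ x ∈ P.ball, IsSubgradient P.ball (P.f i) x (P.gradf i x)
  gradg_mem : ∀ k, ∀ x ∈ P.ball, IsSubgradient P.ball (P.g k) x (P.gradg k x)
  gradf_le : ∀ i, ∀ x ∈ P.ball, ‖P.gradf i x‖ ≤ P.L
  gradg_le : ∀ k, ∀ x ∈ P.ball, ‖P.gradg k x‖ ≤ P.L
  connected : P.G.Connected
  doublyStochastic : P.W ∈ doublyStochastic ℝ (Fin n)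
  weight_pos : ∀ i j, P.G.Adj i j → 0 < P.W i j
  weight_zero : ∀ i j, i ≠ j → ¬ P.G.Adj i j → P.W i j = 0

/-- The stochastic sub-gradient in `x` of the regularized Lagrangian of agent `i`. -/
def stochGradX (i : Fin n) (x : EuclideanSpace ℝ (Fin d)) (lam : Fin m → ℝ) (k : Fin m) :
    EuclideanSpace ℝ (Fin d) :=
  P.gradf i x + (∑ l, |lam l|) • P.gradg k x

/-- The sub-gradient in `λ` of the regularized Lagrangian (the same for all the agents). -/
def gradLam (x : EuclideanSpace ℝ (Fin d)) (lam : Fin m → ℝ) : Fin m → ℝ :=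
  fun k => P.g k x - P.η * lam k

/-- One iteration with step size `a`, agent `i` having drawn the index `K i`: local primal-dual
steps `y`, `γ`, then the consensus step and the projections. -/
def step (a : ℝ) (K : Fin n → Fin m) (S : State d n m) : State d n m :=
  let y : Fin n → EuclideanSpace ℝ (Fin d) :=
    fun i => S.x i - a • P.stochGradX i (S.x i) (S.lam i) (K i)
  let γ : Fin n → Fin m → ℝ := fun i => S.lam i + a • P.gradLam (S.x i) (S.lam i)
  { x := fun i => projBall P.R (∑ j, P.W i j • y j)
    lam := fun i k => max 0 (∑ j, P.W i j * γ j k) }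

/-- The state at time `t`, started at the origin, along the drawn indices `K s i`. -/
def iter (α : ℕ → ℝ) (K : ℕ → Fin n → Fin m) : ℕ → State d n m
  | 0 => { x := fun _ => 0, lam := fun _ _ => 0 }
  | t + 1 => P.step (α t) (K t) (iter α K t)

/-- The estimate of agent `i` after `T` iterations: the weighted average of
`x_i(0), …, x_i(T-1)` with weights `α(0), …, α(T-1)`. -/
def estimate (α : ℕ → ℝ) (K : ℕ → Fin n → Fin m) (T : ℕ) (i : Fin n) :
    EuclideanSpace ℝ (Fin d) :=
  (∑ t ∈ Finset.range T, α t)⁻¹ • ∑ t ∈ Finset.range T, α t • (P.iter α K t).x i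

/-- The random indices `K t i` are those of the algorithm with step sizes `α`: given the past,
`K t i` has the law proportional to the current multipliers of agent `i`. -/
structure IsSampling {Ω : Type*} [MeasurableSpace Ω] (μ : Measure Ω) (α : ℕ → ℝ)
    (K : ℕ → Fin n → Ω → Fin m) : Prop where
  measurable : ∀ t i, Measurable (K t i)
  cond_law : ∀ t i k,
    μ⟦K t i ⁻¹' {k} | history K t⟧ =ᵐ[μ]
      fun ω => samplingProb ((P.iter α (fun s j => K s j ω) t).lam i) k

/-- The step size `R / √(t + 1)`. -/
def stepsize (t : ℕ) : ℝ := P.R / √((t : ℝ) + 1)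

/-- The constant of the convergence rate. -/
def rateConst (T : ℕ) : ℝ :=
  1 + 5 / 2 * (m : ℝ) * P.L ^ 2 * P.R ^ 2 +
    20 * P.L ^ 2 * (1 + (n : ℝ) * (m : ℝ) ^ ((3 : ℝ) / 2) * P.L * P.R / P.η) ^ 2 *
      (Real.log ((T : ℝ) * √((n : ℝ) * (T : ℝ))) / (1 - P.sigma2)) ^ ((3 : ℝ) / 2)

end Problem

end DistPD

end

/-! The proof follows the energy `State.energy z`, the squared distance of all primal-dual pairs to
`(z, 0)` with `z` feasible. Taking 0 as dual comparator suffices because only the cost gap is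
estimated, not the constraint violation.

Mixing by a doubly stochastic matrix does not increase a sum of squares over the agents, and
projecting onto a convex set does not increase distances to its points, so only the local steps can
raise the energy. Convexity bounds the primal cross term below by the local cost gap plus `⟨λ, g⟩`,
minus a sampling error. The dual step contributes the same `⟨λ, g⟩` with the opposite sign, and the
two cancel (`energy_succ_le`). The regularization keeps the multipliers below `2LR/η`, hence the
sub-gradients below `gradBound`.

Telescoping controls the weighted sum of the gaps `f j (x j) - f j z`. Replacing `x j` by `x i`
costs the disagreement of the agents, which the spectral gap makes summable against the steps
(`sum_mul_norm_iter_sub_le`), and Jensen's inequality passes to the averaged iterate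
(`sum_step_mul_cost_sub_le`).

What remains is `totalNoise`, a sum of bounded martingale differences. It has mean zero, which gives
the bound in expectation; its exponential moments are sub-Gaussian (`integral_exp_totalNoise_le`),
so Chernoff's bound gives the one in probability. The sums of steps then turn both into the stated
rate. -/

namespace DistPD

/-! ### Projection onto the ball -/

section Projection

variable {d : ℕ} {R : ℝ}

theorem norm_projBall_le (hR : 0 < R) (v : EuclideanSpace ℝ (Fin d)) : ‖projBall R v‖ ≤ R := by
  have hm : 0 < max R ‖v‖ := lt_max_of_lt_left hR
  rw [projBall, norm_smul, Real.norm_of_nonneg (by positivity), div_mul_eq_mul_div,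
    div_le_iff₀ hm]
  exact mul_le_mul_of_nonneg_left (le_max_right _ _) hR.le

theorem norm_projBall_sub_le (hR : 0 < R) (v : EuclideanSpace ℝ (Fin d))
    {z : EuclideanSpace ℝ (Fin d)} (hz : ‖z‖ ≤ R) : ‖projBall R v - z‖ ≤ ‖v - z‖ := by
  rcases le_or_gt ‖v‖ R with h | h
  · rw [projBall, max_eq_left h, div_self hR.ne', one_smul]
  · rw [projBall, max_eq_right h.le]
    have hv : 0 < ‖v‖ := hR.trans h
    set c : ℝ := R / ‖v‖ with hc
    have hc0 : 0 ≤ c := by positivity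
    have hc1 : c ≤ 1 := by rw [hc, div_le_one hv]; exact h.le
    have hcR : c * ‖v‖ = R := div_mul_cancel₀ _ hv.ne'
    have hi : inner ℝ v z ≤ ‖v‖ * (c * ‖v‖) := by
      refine (real_inner_le_norm v z).trans ?_
      rw [hcR]
      exact mul_le_mul_of_nonneg_left hz hv.le
    refine le_of_sq_le_sq ?_ (norm_nonneg _)
    rw [norm_sub_sq_real, norm_sub_sq_real, norm_smul, real_inner_smul_left,
      Real.norm_of_nonneg hc0]
    nlinarith [mul_nonneg (sub_nonneg.2 hc1) (sub_nonneg.2 hi),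
      mul_nonneg (sq_nonneg (1 - c)) (sq_nonneg ‖v‖)]

end Projection

/-! ### Doubly stochastic mixing and the spectral gap -/

section Mixing

open Finset

variable {n : ℕ} {W : Matrix (Fin n) (Fin n) ℝ}

theorem sum_norm_sq_mix_le {E : Type*} [NormedAddCommGroup E] [NormedSpace ℝ E]
    (hW : W ∈ doublyStochastic ℝ (Fin n)) (y : Fin n → E) :
    ∑ i, ‖∑ j, W i j • y j‖ ^ 2 ≤ ∑ j, ‖y j‖ ^ 2 := by
  have h (i : Fin n) : ‖∑ j, W i j • y j‖ ^ 2 ≤ ∑ j, W i j * ‖y j‖ ^ 2 := by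
    have h1 : ‖∑ j, W i j • y j‖ ≤ ∑ j, W i j * ‖y j‖ :=
      (norm_sum_le _ _).trans_eq <| sum_congr rfl fun j _ => by
        rw [norm_smul, Real.norm_of_nonneg (nonneg_of_mem_doublyStochastic hW)]
    refine (pow_le_pow_left₀ (norm_nonneg _) h1 2).trans ?_
    simpa using (convexOn_pow (𝕜 := ℝ) 2).map_sum_le (t := univ) (w := W i)
      (p := fun j => ‖y j‖) (fun j _ => nonneg_of_mem_doublyStochastic hW)
      (sum_row_of_mem_doublyStochastic hW i) (fun j _ => norm_nonneg _)
  refine (sum_le_sum fun i _ => h i).trans_eq ?_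
  rw [sum_comm]
  exact sum_congr rfl fun j _ => by
    rw [← sum_mul, sum_col_of_mem_doublyStochastic hW, one_mul]

/-- `W` need not be symmetric, so the argument uses an eigenbasis of `A* A`. The all-ones vector is
fixed by `A` and `A*`, and every eigenvalue but the top one is at most `σ² < 1`. Hence that vector
spans the top direction, and a vector of sum zero has no component there. -/
theorem norm_toEuclideanLin_le_singularValue (hn : 2 ≤ n) (hW : W ∈ doublyStochastic ℝ (Fin n))
    (hσ : (Matrix.toEuclideanLin W).singularValues 1 < 1) (v : EuclideanSpace ℝ (Fin n))
    (hv : ∑ i, v i = 0) :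
    ‖Matrix.toEuclideanLin W v‖ ≤ (Matrix.toEuclideanLin W).singularValues 1 * ‖v‖ := by
  set A := Matrix.toEuclideanLin W with hA
  set σ := A.singularValues 1 with hσdef
  have hσ0 : 0 ≤ σ := A.singularValues_nonneg 1
  have hfin : Module.finrank ℝ (EuclideanSpace ℝ (Fin n)) = n := by simp
  have hS := A.isSymmetric_adjoint_comp_self
  set b := hS.eigenvectorBasis hfin with hb
  set ev := hS.eigenvalues hfin with hev
  have hev1 : ev ⟨1, by omega⟩ = σ ^ 2 := (A.sq_singularValues_of_lt hfin (by omega)).symm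
  have hevle (i : Fin n) (hi : i ≠ ⟨0, by omega⟩) : ev i ≤ σ ^ 2 := by
    rw [← hev1]
    refine hS.eigenvalues_antitone hfin ?_
    rw [Fin.le_def]
    rw [Ne, Fin.ext_iff] at hi
    simp only at hi ⊢
    omega
  have hrepr (u : EuclideanSpace ℝ (Fin n)) (i : Fin n) :
      b.repr ((A.adjoint ∘ₗ A) u) i = ev i * b.repr u i := by
    simpa using hS.eigenvectorBasis_apply_self_apply hfin u i
  set o : EuclideanSpace ℝ (Fin n) := WithLp.toLp 2 1 with ho
  have hAo : A o = o := by
    rw [hA, ho, Matrix.toLpLin_toLp, Matrix.toLin'_apply, mulVec_one_of_mem_doublyStochastic hW]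
  have hAo' : A.adjoint o = o := by
    rw [hA, ← Matrix.toEuclideanLin_conjTranspose_eq_adjoint, ho, Matrix.toLpLin_toLp,
      Matrix.conjTranspose_eq_transpose_of_trivial, Matrix.toLin'_apply,
      mulVec_one_of_mem_doublyStochastic (transpose_mem_doublyStochastic_iff.2 hW)]
  have hzero (i : Fin n) (hi : i ≠ ⟨0, by omega⟩) : b.repr o i = 0 := by
    have h := hrepr o i
    rw [LinearMap.comp_apply, hAo, hAo'] at h
    have h1 : ev i < 1 := (hevle i hi).trans_lt (by nlinarith)
    have h2 : (1 - ev i) * b.repr o i = 0 := by linarith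
    exact (mul_eq_zero.1 h2).resolve_left (by linarith)
  have hinner (u w : EuclideanSpace ℝ (Fin n)) :
      inner ℝ u w = ∑ i, b.repr u i * b.repr w i := by
    rw [← b.repr.inner_map_map u w, PiLp.inner_apply]
    exact sum_congr rfl fun i _ => by simp [mul_comm]
  have hov : b.repr v ⟨0, by omega⟩ = 0 := by
    have h1 : inner ℝ o v = (0 : ℝ) := by
      rw [PiLp.inner_apply]
      simpa [ho] using hv
    rw [hinner, sum_eq_single ⟨0, by omega⟩ (fun i _ hi => by rw [hzero i hi, zero_mul])
      (by simp)] at h1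
    refine (mul_eq_zero.1 h1).resolve_left fun h0 => ?_
    have h2 : b.repr o = 0 := by
      ext i
      by_cases hi : i = ⟨0, by omega⟩
      · rw [hi]; exact h0
      · exact hzero i hi
    have h3 : o = 0 := by simpa using h2
    have h4 : o ⟨0, by omega⟩ = 0 := by rw [h3]; rfl
    simp [ho] at h4
  have hsq : ‖A v‖ ^ 2 ≤ (σ * ‖v‖) ^ 2 := by
    rw [← real_inner_self_eq_norm_sq, ← LinearMap.adjoint_inner_right, ← LinearMap.comp_apply,
      hinner, mul_pow, ← real_inner_self_eq_norm_sq v, hinner, mul_sum]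
    refine sum_le_sum fun i _ => ?_
    rw [hrepr]
    by_cases hi : i = ⟨0, by omega⟩
    · rw [hi, hov]; simp
    · nlinarith [mul_le_mul_of_nonneg_right (hevle i hi) (mul_self_nonneg (b.repr v i))]
  exact le_of_sq_le_sq hsq (by positivity)

theorem sum_abs_pow_sub_inv_le (hn : 2 ≤ n) (hW : W ∈ doublyStochastic ℝ (Fin n))
    (hσ : (Matrix.toEuclideanLin W).singularValues 1 < 1) (k : ℕ) (i : Fin n) :
    ∑ j, |(W ^ k) i j - 1 / (n : ℝ)| ≤
      min 2 (√(n : ℝ) * (Matrix.toEuclideanLin W).singularValues 1 ^ k) := by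
  have hn0 : (n : ℝ) ≠ 0 := by positivity
  have hWk : W ^ k ∈ doublyStochastic ℝ (Fin n) := pow_mem hW k
  refine le_min ?_ ?_
  · calc ∑ j, |(W ^ k) i j - 1 / (n : ℝ)| ≤ ∑ j, ((W ^ k) i j + 1 / (n : ℝ)) := by
          refine sum_le_sum fun j _ => (abs_sub _ _).trans_eq ?_
          rw [abs_of_nonneg (nonneg_of_mem_doublyStochastic hWk), abs_of_nonneg (by positivity)]
      _ = 2 := by
          rw [sum_add_distrib, sum_row_of_mem_doublyStochastic hWk]
          simp [hn0]; norm_num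
  · set σ := (Matrix.toEuclideanLin W).singularValues 1 with hσdef
    have hσ0 : 0 ≤ σ := LinearMap.singularValues_nonneg _ 1
    have hpow (k : ℕ) (v : EuclideanSpace ℝ (Fin n)) (hv : ∑ i, v i = 0) :
        ‖Matrix.toEuclideanLin (W ^ k) v‖ ≤ σ ^ k * ‖v‖ := by
      induction k generalizing v with
      | zero => simp [Matrix.toEuclideanLin]
      | succ k ih =>
        have h1 : Matrix.toEuclideanLin (W ^ (k + 1)) v =
            Matrix.toEuclideanLin (W ^ k) (Matrix.toEuclideanLin W v) := by
          apply PiLp.ext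
          intro l
          simp [Matrix.toLpLin_apply, pow_succ]
        rw [h1]
        refine (ih _ ?_).trans ?_
        · have := sum_mulVec_of_mem_doublyStochastic hW (x := v.ofLp)
          simpa [Matrix.toLpLin_apply, hv] using this
        · rw [pow_succ, mul_assoc]
          exact mul_le_mul_of_nonneg_left (norm_toEuclideanLin_le_singularValue hn hW hσ v hv)
            (by positivity)
    set u : EuclideanSpace ℝ (Fin n) := WithLp.toLp 2 fun j => (W ^ k) i j - 1 / (n : ℝ) with hu
    have husum : ∑ j, u j = 0 := by
      simp [hu, sum_sub_distrib, sum_row_of_mem_doublyStochastic hWk, hn0]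
    -- As `u` sums to zero, its norm squared is its pairing with row `i` of `W ^ k`. The contraction
    -- of `W ^ k` thus bounds a row without passing to the transpose.
    have hu2 : ‖u‖ ^ 2 = Matrix.toEuclideanLin (W ^ k) u i := by
      have h1 : ‖u‖ ^ 2 = ∑ j, u j * u j := by
        rw [EuclideanSpace.norm_sq_eq]
        exact sum_congr rfl fun j _ => by rw [Real.norm_eq_abs, sq_abs, sq]
      have h2 : Matrix.toEuclideanLin (W ^ k) u i = ∑ j, (W ^ k) i j * u j := by
        simp only [Matrix.toLpLin_apply, Matrix.mulVec, dotProduct]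
      rw [h1, h2, ← sub_eq_zero, ← sum_sub_distrib]
      have h3 (j : Fin n) : u j * u j - (W ^ k) i j * u j = -(1 / (n : ℝ)) * u j := by
        simp only [hu]; ring
      rw [sum_congr rfl fun j _ => h3 j, ← mul_sum, husum, mul_zero]
    have hule : ‖u‖ ≤ σ ^ k := by
      have h1 : ‖u‖ ^ 2 ≤ σ ^ k * ‖u‖ := by
        rw [hu2]
        refine (le_abs_self _).trans (le_trans ?_ (hpow k u husum))
        simpa using PiLp.norm_apply_le (Matrix.toEuclideanLin (W ^ k) u) i
      rcases (norm_nonneg u).eq_or_lt with h | h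
      · rw [← h]; positivity
      · nlinarith
    have hcs : (∑ j, |u j|) ^ 2 ≤ n * ‖u‖ ^ 2 := by
      have := sq_sum_le_card_mul_sum_sq (s := (univ : Finset (Fin n))) (f := fun j => |u j|)
      rw [EuclideanSpace.norm_sq_eq]
      simpa using this
    have hsq : (∑ j, |u j|) ^ 2 ≤ (√(n : ℝ) * σ ^ k) ^ 2 := by
      rw [mul_pow, Real.sq_sqrt (by positivity)]
      exact hcs.trans (by gcongr)
    exact le_of_sq_le_sq hsq (by positivity)

theorem sum_min_two_geometric_le {N : ℕ} (hN : 1 ≤ N) {σ : ℝ} (hσ0 : 0 ≤ σ) (hσ1 : σ < 1)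
    (t : ℕ) :
    ∑ k ∈ range t, min 2 (√(N : ℝ) * σ ^ k) ≤ (2 * Real.log √(N : ℝ) + 3) / (1 - σ) := by
  set l := Real.log √(N : ℝ) with hl
  have hN1 : (1 : ℝ) ≤ N := by exact_mod_cast hN
  have hs1 : 1 ≤ √(N : ℝ) := Real.one_le_sqrt.2 hN1
  have hs0 : 0 < √(N : ℝ) := by linarith
  have hl0 : 0 ≤ l := Real.log_nonneg hs1
  have hσ' : 0 < 1 - σ := by linarith
  set a := (1 - σ)⁻¹ with ha
  have ha0 : 0 < a := inv_pos.2 hσ'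
  have ha1 : 1 ≤ a := by rw [ha, one_le_inv₀ hσ']; linarith
  -- From index `k₀` on, `√N σ ^ k₀ ≤ 1` and the terms are dominated by a geometric series; before
  -- it, each term is at most 2.
  set k₀ := ⌈l * a⌉₊ with hk₀
  have hk1 : (k₀ : ℝ) ≤ l * a + 1 := (Nat.ceil_lt_add_one (by positivity)).le
  have hk2 : l * a ≤ k₀ := Nat.le_ceil _
  have hdecay : √(N : ℝ) * σ ^ k₀ ≤ 1 := by
    have h1 : σ ≤ Real.exp (-(1 - σ)) := by
      have := Real.add_one_le_exp (-(1 - σ)); linarith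
    have h2 : l ≤ k₀ * (1 - σ) := by
      have := mul_le_mul_of_nonneg_right hk2 hσ'.le
      rwa [mul_assoc, ha, inv_mul_cancel₀ hσ'.ne', mul_one] at this
    calc √(N : ℝ) * σ ^ k₀ ≤ Real.exp l * Real.exp (-(1 - σ)) ^ k₀ := by
          rw [hl, Real.exp_log hs0]; gcongr
      _ = Real.exp (l - k₀ * (1 - σ)) := by
          rw [← Real.exp_nat_mul, ← Real.exp_add]; congr 1; ring
      _ ≤ 1 := Real.exp_le_one_iff.2 (by linarith)
  have hnn (k : ℕ) : 0 ≤ min 2 (√(N : ℝ) * σ ^ k) := le_min (by norm_num) (by positivity)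
  calc ∑ k ∈ range t, min 2 (√(N : ℝ) * σ ^ k)
      ≤ ∑ k ∈ range (k₀ + t), min 2 (√(N : ℝ) * σ ^ k) :=
        sum_le_sum_of_subset_of_nonneg (range_mono (by omega)) fun k _ _ => hnn k
    _ = ∑ k ∈ range k₀, min 2 (√(N : ℝ) * σ ^ k)
        + ∑ k ∈ range t, min 2 (√(N : ℝ) * σ ^ (k₀ + k)) := sum_range_add _ _ _
    _ ≤ ∑ k ∈ range k₀, 2 + ∑ k ∈ range t, σ ^ k := by
        refine add_le_add (sum_le_sum fun k _ => min_le_left _ _) (sum_le_sum fun k _ => ?_)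
        refine (min_le_right _ _).trans ?_
        rw [pow_add, ← mul_assoc]
        exact mul_le_of_le_one_left (by positivity) hdecay
    _ ≤ k₀ * 2 + a := by
        refine add_le_add (by simp) ?_
        have h := mul_neg_geom_sum σ t
        rw [ha, ← one_div, le_div_iff₀ hσ', mul_comm, h]
        have : 0 ≤ σ ^ t := by positivity
        linarith
    _ ≤ (2 * l + 3) / (1 - σ) := by
        rw [div_eq_mul_inv, ← ha]
        nlinarith

end Mixing

/-! ### Sums of the step sizes and of their squares -/

section StepSums

open Finset

theorem two_mul_sqrt_sub_one_le_sum (T : ℕ) :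
    2 * (√(T : ℝ) - 1) ≤ ∑ t ∈ range T, 1 / √((t : ℝ) + 1) := by
  have h : ∀ T : ℕ, 2 * (√((T : ℝ) + 1) - 1) ≤ ∑ t ∈ range T, 1 / √((t : ℝ) + 1) := by
    intro T
    induction T with
    | zero => simp
    | succ T ih =>
      rw [sum_range_succ]
      push_cast
      have h1 : 0 < √((T : ℝ) + 1) := by positivity
      have h2 : √((T : ℝ) + 1) ≤ √((T : ℝ) + 1 + 1) := Real.sqrt_le_sqrt (by linarith)
      have h3 : √((T : ℝ) + 1) ^ 2 = (T : ℝ) + 1 := Real.sq_sqrt (by positivity)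
      have h4 : √((T : ℝ) + 1 + 1) ^ 2 = (T : ℝ) + 1 + 1 := Real.sq_sqrt (by positivity)
      have h5 : 2 * (√((T : ℝ) + 1 + 1) - √((T : ℝ) + 1)) ≤ 1 / √((T : ℝ) + 1) := by
        rw [le_div_iff₀ h1]
        nlinarith
      linarith
  refine le_trans ?_ (h T)
  have : √(T : ℝ) ≤ √((T : ℝ) + 1) := Real.sqrt_le_sqrt (by linarith)
  linarith

/-- The constant fits the base case: the sum at `T = 3` is `11/6 ≤ 15/8`. It is too small at `T =
2`, which `harmonic_mul_le` treats by hand. -/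
theorem harmonic_le_mul_log {T : ℕ} (hT : 3 ≤ T) :
    ∑ t ∈ range T, 1 / ((t : ℝ) + 1) ≤ 15 / 8 * Real.log T := by
  induction T, hT using Nat.le_induction with
  | base =>
    have h : (1 : ℝ) ≤ Real.log 3 := by
      rw [Real.le_log_iff_exp_le (by norm_num)]
      linarith [Real.exp_one_lt_d9]
    simp only [sum_range_succ, sum_range_zero]
    push_cast
    linarith
  | succ T hT ih =>
    have hT0 : (0 : ℝ) < T := by positivity
    rw [sum_range_succ]
    have h := Real.one_sub_inv_le_log_of_pos (x := ((T : ℝ) + 1) / T) (by positivity)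
    rw [Real.log_div (by positivity) hT0.ne'] at h
    have h2 : 1 - (((T : ℝ) + 1) / T)⁻¹ = 1 / ((T : ℝ) + 1) := by field_simp; ring
    have h3 : 0 ≤ 1 / ((T : ℝ) + 1) := by positivity
    rw [h2] at h
    push_cast
    linarith

theorem harmonic_mul_le {T : ℕ} (hT : 2 ≤ T) :
    (∑ t ∈ range T, 1 / ((t : ℝ) + 1)) * (√(T : ℝ) - 1) ≤
      15 / 16 * Real.log T * ∑ t ∈ range T, 1 / √((t : ℝ) + 1) := by
  have hl2 := Real.log_two_gt_d9
  rcases hT.eq_or_lt with rfl | hT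
  · have h1 : √(2 : ℝ) ≤ 1.42 := by
      rw [Real.sqrt_le_left (by norm_num)]; norm_num
    have h0 : 0 < √(2 : ℝ) := by positivity
    have h2 : 1 / 1.42 ≤ 1 / √(2 : ℝ) := one_div_le_one_div_of_le h0 h1
    have h4 : 1.7 ≤ 1 + 1 / √(2 : ℝ) := by
      have : (0.7 : ℝ) ≤ 1 / 1.42 := by norm_num
      linarith
    have h3 : 1.1 ≤ Real.log 2 * (1 + 1 / √(2 : ℝ)) := by nlinarith
    simp only [sum_range_succ, sum_range_zero]
    norm_num at h3 ⊢
    linarith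
  · have h1 := harmonic_le_mul_log (T := T) hT
    have h2 := two_mul_sqrt_sub_one_le_sum T
    have h3 : 1 ≤ √(T : ℝ) := Real.one_le_sqrt.2 (by exact_mod_cast (by omega : 1 ≤ T))
    have h4 : 0 ≤ Real.log T := Real.log_natCast_nonneg T
    calc _ ≤ 15 / 8 * Real.log T * (√(T : ℝ) - 1) :=
          mul_le_mul_of_nonneg_right h1 (by linarith)
      _ = 15 / 16 * Real.log T * (2 * (√(T : ℝ) - 1)) := by ring
      _ ≤ _ := mul_le_mul_of_nonneg_left h2 (by positivity)

end StepSums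

end DistPD

namespace DistPD

/-! ### Disagreement of the agents -/

section Consensus

open Finset

/-- By Young's inequality `a t * a s ≤ (a t ^ 2 + a s ^ 2) / 2`; each half is then summed against
`q` in one of the two orders of summation. -/
theorem sum_mul_sum_convolution_le {a q : ℕ → ℝ} {M : ℝ} (hq : ∀ k, 0 ≤ q k)
    (hM : ∀ t, ∑ k ∈ range t, q k ≤ M) (T : ℕ) :
    ∑ t ∈ range T, a t * ∑ s ∈ range t, a s * q (t - 1 - s) ≤ M * ∑ t ∈ range T, a t ^ 2 := by
  have hyoung (t : ℕ) : a t * ∑ s ∈ range t, a s * q (t - 1 - s) ≤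
      1 / 2 * (a t ^ 2 * M) + 1 / 2 * ∑ s ∈ range t, a s ^ 2 * q (t - 1 - s) := by
    have h1 : a t * ∑ s ∈ range t, a s * q (t - 1 - s) ≤
        ∑ s ∈ range t, (1 / 2 * (a t ^ 2 * q (t - 1 - s)) +
          1 / 2 * (a s ^ 2 * q (t - 1 - s))) := by
      rw [mul_sum]
      refine sum_le_sum fun s _ => ?_
      nlinarith [mul_nonneg (sq_nonneg (a t - a s)) (hq (t - 1 - s))]
    refine h1.trans ?_
    rw [sum_add_distrib, ← mul_sum, ← mul_sum, ← mul_sum, sum_range_reflect q t]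
    have := mul_le_mul_of_nonneg_left (hM t) (sq_nonneg (a t))
    linarith
  have hswap : ∑ t ∈ range T, ∑ s ∈ range t, a s ^ 2 * q (t - 1 - s) ≤
      ∑ s ∈ range T, a s ^ 2 * M := by
    have h1 : ∑ t ∈ range T, ∑ s ∈ range t, a s ^ 2 * q (t - 1 - s) =
        ∑ s ∈ range T, ∑ t ∈ Ico (s + 1) T, a s ^ 2 * q (t - 1 - s) := by
      refine sum_comm' fun t s => ?_
      simp only [mem_range, mem_Ico]
      omega
    rw [h1]
    refine sum_le_sum fun s _ => ?_
    rw [← mul_sum, sum_Ico_eq_sum_range]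
    refine mul_le_mul_of_nonneg_left (le_trans (le_of_eq ?_) (hM (T - (s + 1)))) (sq_nonneg _)
    exact sum_congr rfl fun k _ => by congr 1; omega
  refine (sum_le_sum fun t _ => hyoung t).trans ?_
  rw [sum_add_distrib, ← mul_sum, ← mul_sum, ← sum_mul]
  rw [← sum_mul] at hswap
  linarith

/-- Unrolling the recursion from `X 0 = 0` writes `X t` as the past perturbations transported by
powers of `W`. In a difference of two agents, `1/n` may be subtracted from both rows of weights, and
what is left decays. -/
theorem norm_sub_le_of_perturbed_consensus {E : Type*} [NormedAddCommGroup E] [NormedSpace ℝ E]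
    {n : ℕ} {W : Matrix (Fin n) (Fin n) ℝ} {q c : ℕ → ℝ} (X : ℕ → Fin n → E) (hX : X 0 = 0)
    (hq : ∀ k i, ∑ j, |(W ^ k) i j - 1 / (n : ℝ)| ≤ q k)
    (hc : ∀ t i, ‖X (t + 1) i - ∑ j, W i j • X t j‖ ≤ c t) (t : ℕ) (i j : Fin n) :
    ‖X t i - X t j‖ ≤ ∑ s ∈ range t, c s * (2 * q (t - 1 - s)) := by
  set e : ℕ → Fin n → E := fun t i => X (t + 1) i - ∑ j, W i j • X t j with he
  have hrep (t : ℕ) (i : Fin n) :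
      X t i = ∑ s ∈ range t, ∑ l, (W ^ (t - 1 - s)) i l • e s l := by
    induction t generalizing i with
    | zero => simp [hX]
    | succ t ih =>
      have h1 : X (t + 1) i = ∑ j, W i j • X t j + e t i := by simp [he]
      have h2 : ∑ j, W i j • X t j = ∑ s ∈ range t, ∑ l, (W ^ (t - s)) i l • e s l := by
        simp_rw [ih, smul_sum]
        rw [sum_comm]
        refine sum_congr rfl fun s hs => ?_
        rw [sum_comm]
        refine sum_congr rfl fun l _ => ?_
        have h3 : t - s = (t - 1 - s) + 1 := by rw [mem_range] at hs; omega
        rw [h3, pow_succ', Matrix.mul_apply, sum_smul]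
        exact sum_congr rfl fun j _ => smul_smul _ _ _
      rw [h1, h2, sum_range_succ]
      simp [Matrix.one_apply, ite_smul]
  have hc0 (s : ℕ) : 0 ≤ c s := (norm_nonneg _).trans (hc s i)
  rw [hrep t i, hrep t j, ← sum_sub_distrib]
  refine (norm_sum_le _ _).trans (sum_le_sum fun s _ => ?_)
  rw [← sum_sub_distrib]
  calc ‖∑ l, ((W ^ (t - 1 - s)) i l • e s l - (W ^ (t - 1 - s)) j l • e s l)‖
      ≤ ∑ l, (|(W ^ (t - 1 - s)) i l - 1 / (n : ℝ)| + |(W ^ (t - 1 - s)) j l - 1 / (n : ℝ)|)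
          * c s := by
        refine (norm_sum_le _ _).trans (sum_le_sum fun l _ => ?_)
        rw [← sub_smul, norm_smul, Real.norm_eq_abs]
        refine mul_le_mul ?_ (hc s l) (norm_nonneg _) (by positivity)
        refine le_trans (le_of_eq ?_) (abs_sub _ _)
        congr 1; ring
    _ ≤ c s * (2 * q (t - 1 - s)) := by
        rw [← sum_mul, sum_add_distrib, mul_comm]
        exact mul_le_mul_of_nonneg_left (by linarith [hq (t - 1 - s) i, hq (t - 1 - s) j]) (hc0 s)

end Consensus

/-! ### Sub-gradients, the sampling law and bounds along the iteration -/

theorem IsSubgradient.sub_le {d : ℕ} {s : Set (EuclideanSpace ℝ (Fin d))}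
    {h : EuclideanSpace ℝ (Fin d) → ℝ} {x v y : EuclideanSpace ℝ (Fin d)} {L : ℝ}
    (hv : IsSubgradient s h x v) (hL : ‖v‖ ≤ L) (hy : y ∈ s) : h x - h y ≤ L * ‖x - y‖ := by
  have h1 := hv y hy
  have h2 : -inner ℝ v (y - x) ≤ L * ‖x - y‖ := by
    rw [← inner_neg_right, neg_sub]
    exact (real_inner_le_norm _ _).trans (mul_le_mul_of_nonneg_right hL (norm_nonneg _))
  linarith

theorem samplingProb_nonneg {m : ℕ} {lam : Fin m → ℝ} (h : ∀ k, 0 ≤ lam k) (k : Fin m) :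
    0 ≤ samplingProb lam k := by
  unfold samplingProb
  split_ifs
  · positivity
  · exact div_nonneg (h k) (Finset.sum_nonneg fun _ _ => abs_nonneg _)

theorem sum_abs_pos {m : ℕ} {lam : Fin m → ℝ} (h : lam ≠ 0) : 0 < ∑ l, |lam l| := by
  obtain ⟨k, hk⟩ := Function.ne_iff.1 h
  exact Finset.sum_pos' (fun _ _ => abs_nonneg _) ⟨k, Finset.mem_univ _, abs_pos.2 hk⟩

theorem sum_samplingProb {m : ℕ} (hm : 0 < m) {lam : Fin m → ℝ} (h : ∀ k, 0 ≤ lam k) :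
    ∑ k, samplingProb lam k = 1 := by
  unfold samplingProb
  split_ifs with h0
  · have : (m : ℝ) ≠ 0 := by positivity
    simp [this]
  · rw [← Finset.sum_div, div_eq_one_iff_eq (sum_abs_pos h0).ne']
    exact Finset.sum_congr rfl fun k _ => (abs_of_nonneg (h k)).symm

/-- This makes the sampled sub-gradient unbiased. For vanishing multipliers both sides are zero,
whatever the law. -/
theorem sum_abs_mul_samplingProb {m : ℕ} (lam : Fin m → ℝ) (k : Fin m) :
    (∑ l, |lam l|) * samplingProb lam k = lam k := by
  unfold samplingProb
  split_ifs with h0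
  · simp [h0]
  · exact mul_div_cancel₀ _ (sum_abs_pos h0).ne'

/-- The primal and dual squared distances to `(z, 0)`, summed over the agents. -/
noncomputable def State.energy {d n m : ℕ} (z : EuclideanSpace ℝ (Fin d)) (S : State d n m) : ℝ :=
  ∑ j, (‖S.x j - z‖ ^ 2 + ∑ k, S.lam j k ^ 2)

namespace Problem

open Finset

variable {d n m : ℕ} (P : Problem d n m)

/-- A bound for the stochastic sub-gradients along the iteration. -/
noncomputable def gradBound : ℝ :=
  P.L * (1 + (n : ℝ) * (m : ℝ) ^ ((3 : ℝ) / 2) * P.L * P.R / P.η)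

/-- The value at the direction `x i - z` of the random part of the sub-gradient in `x`, when agent
`i` draws the index `k`. -/
noncomputable def sampledSlope (z : EuclideanSpace ℝ (Fin d)) (S : State d n m) (i : Fin n) (k : Fin m) : ℝ :=
  (∑ l, |S.lam i l|) * inner ℝ (P.gradg k (S.x i)) (S.x i - z)

/-- The sampling error of agent `i` in the direction `x i - z` when it draws the index `k`. -/
noncomputable def noise (z : EuclideanSpace ℝ (Fin d)) (S : State d n m) (i : Fin n)
    (k : Fin m) : ℝ :=
  (∑ l, samplingProb (S.lam i) l * P.sampledSlope z S i l) - P.sampledSlope z S i k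

variable {P}

theorem mem_ball {x : EuclideanSpace ℝ (Fin d)} : x ∈ P.ball ↔ ‖x‖ ≤ P.R := by
  simp [ball]

namespace Standing

variable (hP : P.Standing)
include hP

theorem feasible_subset : P.feasible ⊆ P.ball := hP.radius_least.1.2

omit hP in
theorem norm_sub_le_of_mem_ball {x y : EuclideanSpace ℝ (Fin d)} (hx : x ∈ P.ball) (hy : y ∈ P.ball) :
    ‖x - y‖ ≤ 2 * P.R := by
  rw [mem_ball] at hx hy
  linarith [norm_sub_le x y]

theorem zero_mem : (0 : EuclideanSpace ℝ (Fin d)) ∈ P.ball := by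
  rw [mem_ball, norm_zero]; exact hP.radius_pos.le

theorem L_nonneg (hn : 0 < n) : 0 ≤ P.L :=
  (norm_nonneg _).trans (hP.gradf_le ⟨0, hn⟩ 0 hP.zero_mem)

theorem f_sub_le (i : Fin n) {x y : EuclideanSpace ℝ (Fin d)} (hx : x ∈ P.ball)
    (hy : y ∈ P.ball) : P.f i x - P.f i y ≤ P.L * ‖x - y‖ :=
  (hP.gradf_mem i x hx).sub_le (hP.gradf_le i x hx) hy

theorem g_sub_le (hL : 0 ≤ P.L) (k : Fin m) {x y : EuclideanSpace ℝ (Fin d)} (hx : x ∈ P.ball)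
    (hy : y ∈ P.ball) : P.g k x - P.g k y ≤ 2 * P.L * P.R := by
  have h1 := (hP.gradg_mem k x hx).sub_le (hP.gradg_le k x hx) hy
  have h2 := mul_le_mul_of_nonneg_left (norm_sub_le_of_mem_ball hx hy) hL
  linarith

theorem g_le (hL : 0 ≤ P.L) (k : Fin m) {x : EuclideanSpace ℝ (Fin d)} (hx : x ∈ P.ball) :
    P.g k x ≤ 2 * P.L * P.R := by
  obtain ⟨z, hz⟩ := hP.feasible_nonempty
  linarith [hP.g_sub_le hL k hx (hP.feasible_subset hz), hz k]

/-- A constraint positive somewhere on the ball is bounded below by the Lipschitz estimate. Any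
other one may be very negative, but its multiplier never leaves zero (`iter_lam_eq_zero`). -/
theorem g_nonpos_or_abs_le (hL : 0 ≤ P.L) (k : Fin m) :
    (∀ x ∈ P.ball, P.g k x ≤ 0) ∨ ∀ x ∈ P.ball, |P.g k x| ≤ 2 * P.L * P.R := by
  by_cases h : ∀ x ∈ P.ball, P.g k x ≤ 0
  · exact Or.inl h
  · push Not at h
    obtain ⟨y, hy, hgy⟩ := h
    refine Or.inr fun x hx => abs_le.2 ⟨?_, hP.g_le hL k hx⟩
    linarith [hP.g_sub_le hL k hy hx]

variable {α : ℕ → ℝ} (K : ℕ → Fin n → Fin m)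

theorem iter_mem_ball (t : ℕ) (i : Fin n) : (P.iter α K t).x i ∈ P.ball := by
  cases t with
  | zero => exact hP.zero_mem
  | succ t => exact mem_ball.2 (norm_projBall_le hP.radius_pos _)

omit hP in
theorem iter_lam_nonneg (t : ℕ) (i : Fin n) (k : Fin m) : 0 ≤ (P.iter α K t).lam i k := by
  cases t with
  | zero => exact le_rfl
  | succ t => exact le_max_left _ _

omit hP in
theorem gradLam_step (a : ℝ) (S : State d n m) (j : Fin n) (k : Fin m) :
    (S.lam j + a • P.gradLam (S.x j) (S.lam j)) k =
      (1 - P.η * a) * S.lam j k + a * P.g k (S.x j) := by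
  simp [gradLam]; ring

theorem mix_mem_ball {y : Fin n → EuclideanSpace ℝ (Fin d)} (hy : ∀ j, y j ∈ P.ball)
    (i : Fin n) : ∑ j, P.W i j • y j ∈ P.ball :=
  (convex_closedBall _ _).sum_mem
    (fun _ _ => nonneg_of_mem_doublyStochastic hP.doublyStochastic)
    (sum_row_of_mem_doublyStochastic hP.doublyStochastic i) fun j _ => hy j

theorem mix_le {u : Fin n → ℝ} {b : ℝ} (hu : ∀ j, u j ≤ b) (i : Fin n) :
    ∑ j, P.W i j * u j ≤ b := by
  calc ∑ j, P.W i j * u j ≤ ∑ j, P.W i j * b := sum_le_sum fun j _ =>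
        mul_le_mul_of_nonneg_left (hu j) (nonneg_of_mem_doublyStochastic hP.doublyStochastic)
    _ = b := by rw [← sum_mul, sum_row_of_mem_doublyStochastic hP.doublyStochastic, one_mul]

variable (hη : 0 < P.η) (hα : ∀ t, 0 ≤ α t) (hαη : ∀ t, P.η * α t ≤ 1 / 2)
include hη hα hαη

/-- The bound is the fixed point of `b ↦ (1 - ηα) b + α · 2LR`, so the regularized dual step
preserves it, as do averaging and projection. -/
theorem iter_lam_le (hL : 0 ≤ P.L) (t : ℕ) (i : Fin n) (k : Fin m) :
    (P.iter α K t).lam i k ≤ 2 * P.L * P.R / P.η := by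
  have hR := hP.radius_pos
  have hb : 0 ≤ 2 * P.L * P.R / P.η := by positivity
  induction t generalizing i with
  | zero => exact hb
  | succ t ih =>
    refine max_le hb (hP.mix_le (fun j => ?_) i)
    refine (gradLam_step _ _ j k).trans_le ?_
    have h1 := mul_le_mul_of_nonneg_left (ih j) (by linarith [hαη t] : 0 ≤ 1 - P.η * α t)
    have h2 := mul_le_mul_of_nonneg_left (hP.g_le hL k (hP.iter_mem_ball K (α := α) t j)) (hα t)
    have h3 : (1 - P.η * α t) * (2 * P.L * P.R / P.η) + α t * (2 * P.L * P.R) =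
        2 * P.L * P.R / P.η := by field_simp; ring
    linarith

omit hη hαη in
theorem iter_lam_eq_zero {k : Fin m} (hk : ∀ x ∈ P.ball, P.g k x ≤ 0) (t : ℕ) (i : Fin n) :
    (P.iter α K t).lam i k = 0 := by
  induction t generalizing i with
  | zero => rfl
  | succ t ih =>
    refine max_eq_left (hP.mix_le (fun j => ?_) i)
    refine (gradLam_step _ _ j k).trans_le ?_
    rw [ih j, mul_zero, zero_add]
    exact mul_nonpos_of_nonneg_of_nonpos (hα t) (hk _ (hP.iter_mem_ball K t j))

theorem sum_abs_lam_le (hL : 0 ≤ P.L) (t : ℕ) (i : Fin n) :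
    ∑ k, |(P.iter α K t).lam i k| ≤ 2 * m * P.L * P.R / P.η := by
  calc ∑ k, |(P.iter α K t).lam i k| ≤ ∑ k : Fin m, 2 * P.L * P.R / P.η :=
        sum_le_sum fun k _ => by
          rw [abs_of_nonneg (iter_lam_nonneg K t i k)]
          exact hP.iter_lam_le K hη hα hαη hL t i k
    _ = 2 * m * P.L * P.R / P.η := by simp; ring

theorem abs_noise_le {z : EuclideanSpace ℝ (Fin d)} (hz : z ∈ P.ball) (hL : 0 ≤ P.L) (t : ℕ)
    (i : Fin n) (k : Fin m) :
    |P.noise z (P.iter α K t) i k| ≤ 8 * m * P.L ^ 2 * P.R ^ 2 / P.η := by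
  have hR := hP.radius_pos
  set S := P.iter α K t with hS
  have hm : 0 < m := k.pos
  have hslope (l : Fin m) : |P.sampledSlope z S i l| ≤ 4 * m * P.L ^ 2 * P.R ^ 2 / P.η := by
    have hx := hP.iter_mem_ball K (α := α) t i
    have h1 : |inner ℝ (P.gradg l (S.x i)) (S.x i - z)| ≤ P.L * (2 * P.R) :=
      (abs_real_inner_le_norm _ _).trans
        (mul_le_mul (hP.gradg_le l _ hx) (norm_sub_le_of_mem_ball hx hz) (norm_nonneg _) hL)
    rw [sampledSlope, abs_mul, abs_of_nonneg (sum_nonneg fun _ _ => abs_nonneg _)]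
    refine (mul_le_mul (hP.sum_abs_lam_le K hη hα hαη hL t i) h1 (abs_nonneg _)
      (by positivity)).trans_eq ?_
    ring
  have hlam := iter_lam_nonneg (P := P) (α := α) K t i
  have hmean : |∑ l, samplingProb (S.lam i) l * P.sampledSlope z S i l| ≤
      4 * m * P.L ^ 2 * P.R ^ 2 / P.η := by
    refine (abs_sum_le_sum_abs _ _).trans ?_
    calc _ ≤ ∑ l, samplingProb (S.lam i) l * (4 * m * P.L ^ 2 * P.R ^ 2 / P.η) :=
          sum_le_sum fun l _ => by
            rw [abs_mul, abs_of_nonneg (samplingProb_nonneg hlam l)]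
            exact mul_le_mul_of_nonneg_left (hslope l) (samplingProb_nonneg hlam l)
      _ = _ := by rw [← sum_mul, sum_samplingProb hm hlam, one_mul]
  refine (abs_sub _ _).trans ((add_le_add hmean (hslope k)).trans_eq ?_)
  ring

theorem norm_stochGradX_le (hn : 2 ≤ n) (hm : 0 < m) (t : ℕ) (i : Fin n) (k : Fin m) :
    ‖P.stochGradX i ((P.iter α K t).x i) ((P.iter α K t).lam i) k‖ ≤ P.gradBound := by
  have hL := hP.L_nonneg (by omega)
  have hR := hP.radius_pos
  have hx := hP.iter_mem_ball K (α := α) t i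
  have hlam := hP.sum_abs_lam_le K hη hα hαη hL t i
  have h0 : 0 ≤ ∑ k, |(P.iter α K t).lam i k| := sum_nonneg fun _ _ => abs_nonneg _
  have hm1 : (1 : ℝ) ≤ m := by exact_mod_cast hm
  have hmp : (m : ℝ) ≤ (m : ℝ) ^ ((3 : ℝ) / 2) := by
    simpa using Real.rpow_le_rpow_of_exponent_le hm1 (by norm_num : (1 : ℝ) ≤ 3 / 2)
  have hn2 : (2 : ℝ) ≤ n := by exact_mod_cast hn
  have h1 : 2 * m * P.L * P.R / P.η ≤ (n : ℝ) * (m : ℝ) ^ ((3 : ℝ) / 2) * P.L * P.R / P.η := by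
    gcongr
  calc _ ≤ P.L + (∑ k, |(P.iter α K t).lam i k|) * P.L := by
        refine (norm_add_le _ _).trans (add_le_add (hP.gradf_le i _ hx) ?_)
        rw [norm_smul, Real.norm_of_nonneg h0]
        exact mul_le_mul_of_nonneg_left (hP.gradg_le k _ hx) h0
    _ ≤ P.gradBound := by
        rw [gradBound, mul_add, mul_one, mul_comm P.L (_ / _)]
        gcongr
        exact hlam.trans h1

theorem norm_iter_succ_sub_mix_le (hn : 2 ≤ n) (hm : 0 < m) (t : ℕ) (i : Fin n) :
    ‖(P.iter α K (t + 1)).x i - ∑ j, P.W i j • (P.iter α K t).x j‖ ≤ α t * P.gradBound := by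
  have h1 := mem_ball.1 (hP.mix_mem_ball (fun j => hP.iter_mem_ball K (α := α) t j) i)
  refine (norm_projBall_sub_le hP.radius_pos _ h1).trans ?_
  rw [← sum_sub_distrib]
  refine (norm_sum_le _ _).trans ?_
  refine le_trans (sum_le_sum fun j _ => ?_)
    (hP.mix_le (u := fun _ => α t * P.gradBound) (fun j => le_rfl) i)
  rw [← smul_sub, norm_smul,
    Real.norm_of_nonneg (nonneg_of_mem_doublyStochastic hP.doublyStochastic)]
  refine mul_le_mul_of_nonneg_left ?_ (nonneg_of_mem_doublyStochastic hP.doublyStochastic)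
  rw [sub_sub_cancel_left, norm_neg, norm_smul, Real.norm_of_nonneg (hα t)]
  exact mul_le_mul_of_nonneg_left (hP.norm_stochGradX_le K hη hα hαη hn hm t j (K t j)) (hα t)

theorem sum_mul_norm_iter_sub_le (hn : 2 ≤ n) (hm : 0 < m) (hσ : P.sigma2 < 1) (T : ℕ)
    (i j : Fin n) :
    ∑ t ∈ range T, α t * ‖(P.iter α K t).x i - (P.iter α K t).x j‖ ≤
      2 * P.gradBound * ((2 * Real.log √(n : ℝ) + 3) / (1 - P.sigma2)) *
        ∑ t ∈ range T, α t ^ 2 := by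
  have hσ0 : 0 ≤ P.sigma2 := LinearMap.singularValues_nonneg _ 1
  set q : ℕ → ℝ := fun k => min 2 (√(n : ℝ) * P.sigma2 ^ k) with hq
  have hG : 0 ≤ P.gradBound :=
    (norm_nonneg _).trans (hP.norm_stochGradX_le K hη hα hαη hn hm 0 i (K 0 i))
  have hdiff (t : ℕ) := norm_sub_le_of_perturbed_consensus (q := q)
    (c := fun t => α t * P.gradBound) (fun t => (P.iter α K t).x) rfl
    (sum_abs_pow_sub_inv_le hn hP.doublyStochastic hσ)
    (hP.norm_iter_succ_sub_mix_le K hη hα hαη hn hm) t i j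
  have hconv := sum_mul_sum_convolution_le (a := α) (q := q)
    (fun k => le_min (by norm_num) (by positivity))
    (sum_min_two_geometric_le (N := n) (by omega) hσ0 hσ) T
  calc _ ≤ ∑ t ∈ range T, 2 * P.gradBound * (α t * ∑ s ∈ range t, α s * q (t - 1 - s)) := by
        refine sum_le_sum fun t _ =>
          (mul_le_mul_of_nonneg_left (hdiff t) (hα t)).trans_eq ?_
        rw [mul_sum, mul_sum, mul_sum]
        exact sum_congr rfl fun s _ => by ring
    _ ≤ _ := by
        rw [← mul_sum, mul_assoc (2 * P.gradBound)]
        exact mul_le_mul_of_nonneg_left hconv (by positivity)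

/-! ### Energy inequality and the pathwise bound on the cost gap -/

omit hη hα hαη in
theorem sub_le_inner_sub_noise {z : EuclideanSpace ℝ (Fin d)} (hz : z ∈ P.feasible) (t : ℕ)
    (j : Fin n) (k : Fin m) :
    P.f j ((P.iter α K t).x j) - P.f j z +
        ∑ l, (P.iter α K t).lam j l * P.g l ((P.iter α K t).x j) ≤
      inner ℝ (P.stochGradX j ((P.iter α K t).x j) ((P.iter α K t).lam j) k)
        ((P.iter α K t).x j - z) + P.noise z (P.iter α K t) j k := by
  have hx := hP.iter_mem_ball K (α := α) t j
  have hzb := hP.feasible_subset hz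
  have hlam := iter_lam_nonneg (P := P) (α := α) K t j
  set S := P.iter α K t
  have hf := hP.gradf_mem j _ hx z hzb
  rw [← neg_sub (S.x j), inner_neg_right] at hf
  have hg : ∑ l, S.lam j l * P.g l (S.x j) ≤
      ∑ l, samplingProb (S.lam j) l * P.sampledSlope z S j l := by
    refine sum_le_sum fun l _ => ?_
    have h1 := hP.gradg_mem l _ hx z hzb
    rw [← neg_sub (S.x j), inner_neg_right] at h1
    rw [sampledSlope, ← mul_assoc, mul_comm (samplingProb _ _), sum_abs_mul_samplingProb]
    exact mul_le_mul_of_nonneg_left (by linarith [hz l]) (hlam l)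
  rw [noise, stochGradX, inner_add_left, real_inner_smul_left]
  have : P.sampledSlope z S j k = (∑ l, |S.lam j l|) * inner ℝ (P.gradg k (S.x j)) (S.x j - z) :=
    rfl
  linarith

theorem sum_lam_succ_sq_le (hL : 0 ≤ P.L) (t : ℕ) (k : Fin m) :
    ∑ i, (P.iter α K (t + 1)).lam i k ^ 2 ≤ ∑ j, ((P.iter α K t).lam j k ^ 2 +
      2 * α t * ((P.iter α K t).lam j k * P.g k ((P.iter α K t).x j)) +
        α t ^ 2 * (16 / 3 * P.L ^ 2 * P.R ^ 2)) := by
  rcases hP.g_nonpos_or_abs_le hL k with hk | hk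
  · refine sum_le_sum fun j _ => ?_
    rw [hP.iter_lam_eq_zero K hα hk, hP.iter_lam_eq_zero K hα hk]
    have : 0 ≤ α t ^ 2 * (16 / 3 * P.L ^ 2 * P.R ^ 2) := by positivity
    linarith
  · set S := P.iter α K t with hS
    have h1 : ∑ i, (P.iter α K (t + 1)).lam i k ^ 2 ≤
        ∑ i, ‖∑ j, P.W i j • (S.lam j + α t • P.gradLam (S.x j) (S.lam j)) k‖ ^ 2 := by
      refine sum_le_sum fun i _ => ?_
      rw [Real.norm_eq_abs]
      refine pow_le_pow_left₀ (iter_lam_nonneg K (t + 1) i k) ?_ 2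
      exact max_le (abs_nonneg _) (le_abs_self _)
    refine (h1.trans (sum_norm_sq_mix_le hP.doublyStochastic _)).trans (sum_le_sum fun j _ => ?_)
    rw [gradLam_step, Real.norm_eq_abs, sq_abs]
    have hg := hk _ (hP.iter_mem_ball K (α := α) t j)
    have hg2 : P.g k (S.x j) ^ 2 ≤ (2 * P.L * P.R) ^ 2 := sq_le_sq' (abs_le.1 hg).1 (abs_le.1 hg).2
    have ha := mul_nonneg (mul_nonneg hη.le (hα t)) (by linarith [hαη t] : 0 ≤ 1 / 2 - P.η * α t)
    set u := S.lam j k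
    set v := P.g k (S.x j)
    -- The gap between the two sides is at least `a²(v + 3ηu)²/3 + 4ηa(1/2 - ηa)u²` with `a = α t`.
    -- The constant is `16/3 · L²R² = 4/3 · (2LR)²`, and `ηa ≤ 1/2` is exactly what the last term
    -- needs.
    nlinarith [mul_le_mul_of_nonneg_left hg2 (sq_nonneg (α t)), mul_nonneg ha (sq_nonneg u),
      sq_nonneg (α t * (v + 3 * P.η * u))]

theorem energy_succ_le (hn : 2 ≤ n) {z : EuclideanSpace ℝ (Fin d)} (hz : z ∈ P.feasible)
    (t : ℕ) :
    (P.iter α K (t + 1)).energy z ≤ (P.iter α K t).energy z +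
      ∑ j, (2 * α t * (P.noise z (P.iter α K t) j (K t j) -
          (P.f j ((P.iter α K t).x j) - P.f j z)) +
        α t ^ 2 * (P.gradBound ^ 2 + 16 / 3 * m * P.L ^ 2 * P.R ^ 2)) := by
  have hm : 0 < m := (K 0 ⟨0, by omega⟩).pos
  have hL := hP.L_nonneg (by omega)
  set S := P.iter α K t with hS
  have hprimal : ∑ i, ‖(P.iter α K (t + 1)).x i - z‖ ^ 2 ≤
      ∑ j, (‖S.x j - z‖ ^ 2 -
        2 * α t * inner ℝ (P.stochGradX j (S.x j) (S.lam j) (K t j)) (S.x j - z) +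
          α t ^ 2 * P.gradBound ^ 2) := by
    have h1 : ∑ i, ‖(P.iter α K (t + 1)).x i - z‖ ^ 2 ≤
        ∑ i, ‖∑ j, P.W i j • (S.x j - α t • P.stochGradX j (S.x j) (S.lam j) (K t j) - z)‖ ^ 2 := by
      refine sum_le_sum fun i _ => pow_le_pow_left₀ (norm_nonneg _) ?_ 2
      have h2 : ∑ j, P.W i j • (S.x j - α t • P.stochGradX j (S.x j) (S.lam j) (K t j) - z) =
          ∑ j, P.W i j • (S.x j - α t • P.stochGradX j (S.x j) (S.lam j) (K t j)) - z := by
        simp_rw [smul_sub _ _ z]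
        rw [sum_sub_distrib, ← sum_smul, sum_row_of_mem_doublyStochastic hP.doublyStochastic,
          one_smul]
      rw [h2]
      exact norm_projBall_sub_le hP.radius_pos _ (mem_ball.1 (hP.feasible_subset hz))
    refine (h1.trans (sum_norm_sq_mix_le hP.doublyStochastic _)).trans (sum_le_sum fun j _ => ?_)
    have h3 := hP.norm_stochGradX_le K hη hα hαη hn hm t j (K t j)
    rw [sub_right_comm, norm_sub_sq_real, norm_smul, real_inner_smul_right, mul_pow,
      Real.norm_eq_abs, sq_abs, real_inner_comm]
    have h4 := mul_le_mul_of_nonneg_left (pow_le_pow_left₀ (norm_nonneg _) h3 2)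
      (sq_nonneg (α t))
    linarith
  have hdual : ∑ i, ∑ k, (P.iter α K (t + 1)).lam i k ^ 2 ≤
      ∑ j, (∑ k, S.lam j k ^ 2 + 2 * α t * ∑ k, S.lam j k * P.g k (S.x j) +
        α t ^ 2 * (16 / 3 * m * P.L ^ 2 * P.R ^ 2)) := by
    rw [sum_comm]
    refine (sum_le_sum fun k _ => hP.sum_lam_succ_sq_le K hη hα hαη hL t k).trans_eq ?_
    rw [sum_comm]
    refine sum_congr rfl fun j _ => ?_
    rw [sum_add_distrib, sum_add_distrib, ← mul_sum]
    simp only [sum_const, card_univ, Fintype.card_fin, nsmul_eq_mul]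
    ring
  unfold State.energy
  rw [sum_add_distrib]
  refine (add_le_add hprimal hdual).trans ?_
  rw [← sum_add_distrib, ← sum_add_distrib]
  refine sum_le_sum fun j _ => ?_
  have h5 := mul_le_mul_of_nonneg_left (hP.sub_le_inner_sub_noise (α := α) K hz t j (K t j)) (hα t)
  linarith

theorem sum_step_mul_gap_le (hn : 2 ≤ n) {z : EuclideanSpace ℝ (Fin d)} (hz : z ∈ P.feasible)
    (T : ℕ) :
    ∑ t ∈ range T, α t * ((1 / (n : ℝ)) * ∑ j, (P.f j ((P.iter α K t).x j) - P.f j z)) ≤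
      P.R ^ 2 / 2 + (∑ t ∈ range T, α t ^ 2) *
          (P.gradBound ^ 2 / 2 + 8 / 3 * m * P.L ^ 2 * P.R ^ 2) +
        ∑ t ∈ range T, α t * ((1 / (n : ℝ)) * ∑ j, P.noise z (P.iter α K t) j (K t j)) := by
  have hn0 : (0 : ℝ) < n := by positivity
  have hstep (t : ℕ) : α t * ((1 / (n : ℝ)) * ∑ j, (P.f j ((P.iter α K t).x j) - P.f j z)) ≤
      1 / (2 * n) * ((P.iter α K t).energy z - (P.iter α K (t + 1)).energy z) +
        α t ^ 2 * (P.gradBound ^ 2 / 2 + 8 / 3 * m * P.L ^ 2 * P.R ^ 2) +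
        α t * ((1 / (n : ℝ)) * ∑ j, P.noise z (P.iter α K t) j (K t j)) := by
    have h := hP.energy_succ_le K hη hα hαη hn hz t
    rw [sum_add_distrib, ← mul_sum, sum_sub_distrib (fun j => P.noise z (P.iter α K t) j (K t j))]
      at h
    simp only [sum_const, card_univ, Fintype.card_fin, nsmul_eq_mul] at h
    have h2 := mul_le_mul_of_nonneg_left h (by positivity : 0 ≤ 1 / (2 * (n : ℝ)))
    have e1 : ∀ u v : ℝ, 1 / (2 * (n : ℝ)) * (2 * α t * u + n * v) =
        α t * (1 / n * u) + v / 2 := by intro u v; field_simp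
    rw [mul_add, e1] at h2
    linarith
  refine (sum_le_sum fun t _ => hstep t).trans ?_
  rw [sum_add_distrib, sum_add_distrib, ← mul_sum, sum_range_sub', ← sum_mul]
  have h0 : (P.iter α K 0).energy z ≤ n * P.R ^ 2 := by
    have h1 : ∀ j : Fin n, ‖(P.iter α K 0).x j - z‖ ^ 2 + ∑ k, (P.iter α K 0).lam j k ^ 2 ≤
        P.R ^ 2 := fun j => by
      simpa [iter] using pow_le_pow_left₀ (norm_nonneg _) (mem_ball.1 (hP.feasible_subset hz)) 2
    exact (sum_le_sum fun j _ => h1 j).trans_eq (by simp)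
  have h1 : 0 ≤ (P.iter α K T).energy z :=
    sum_nonneg fun j _ => add_nonneg (sq_nonneg _) (sum_nonneg fun k _ => sq_nonneg _)
  have h2 : 1 / (2 * (n : ℝ)) * ((P.iter α K 0).energy z - (P.iter α K T).energy z) ≤
      1 / (2 * (n : ℝ)) * (n * P.R ^ 2) :=
    mul_le_mul_of_nonneg_left (by linarith) (by positivity)
  have h3 : 1 / (2 * (n : ℝ)) * (n * P.R ^ 2) = P.R ^ 2 / 2 := by field_simp
  linarith

theorem sum_step_mul_cost_sub_le (hn : 2 ≤ n) (hσ : P.sigma2 < 1)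
    {z : EuclideanSpace ℝ (Fin d)} (hz : z ∈ P.feasible) {T : ℕ}
    (hT : 0 < ∑ t ∈ range T, α t) (i : Fin n) :
    (∑ t ∈ range T, α t) * (P.cost (P.estimate α K T i) - P.cost z) ≤
      P.R ^ 2 / 2 + (∑ t ∈ range T, α t ^ 2) *
          (P.gradBound ^ 2 / 2 + 8 / 3 * m * P.L ^ 2 * P.R ^ 2 +
            2 * P.L * P.gradBound * ((2 * Real.log √(n : ℝ) + 3) / (1 - P.sigma2))) +
        ∑ t ∈ range T, α t * ((1 / (n : ℝ)) * ∑ j, P.noise z (P.iter α K t) j (K t j)) := by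
  have hm : 0 < m := (K 0 ⟨0, by omega⟩).pos
  have hL := hP.L_nonneg (by omega)
  have hn0 : (0 : ℝ) < n := by positivity
  set D := 2 * P.gradBound * ((2 * Real.log √(n : ℝ) + 3) / (1 - P.sigma2)) *
    ∑ t ∈ range T, α t ^ 2 with hD
  have hjensen (j : Fin n) : (∑ t ∈ range T, α t) * P.f j (P.estimate α K T i) ≤
      ∑ t ∈ range T, α t * P.f j ((P.iter α K t).x i) := by
    have h := (hP.f_convex j).map_centerMass_le (t := range T) (w := α)
      (p := fun t => (P.iter α K t).x i) (fun t _ => hα t) hT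
      (fun t _ => hP.iter_mem_ball K t i)
    have h2 := mul_le_mul_of_nonneg_left h hT.le
    rwa [centerMass, centerMass, smul_eq_mul, mul_inv_cancel_left₀ hT.ne'] at h2
  have hj (j : Fin n) : (∑ t ∈ range T, α t) * (P.f j (P.estimate α K T i) - P.f j z) ≤
      ∑ t ∈ range T, α t * (P.f j ((P.iter α K t).x j) - P.f j z) + P.L * D := by
    have h1 := hP.sum_mul_norm_iter_sub_le K hη hα hαη hn hm hσ T i j
    have h2 : ∑ t ∈ range T, α t * P.f j ((P.iter α K t).x i) ≤
        ∑ t ∈ range T, (α t * (P.f j ((P.iter α K t).x j)) +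
          P.L * (α t * ‖(P.iter α K t).x i - (P.iter α K t).x j‖)) := by
      refine sum_le_sum fun t _ => ?_
      have := mul_le_mul_of_nonneg_left
        (hP.f_sub_le j (hP.iter_mem_ball K (α := α) t i) (hP.iter_mem_ball K (α := α) t j)) (hα t)
      linarith
    rw [sum_add_distrib, ← mul_sum] at h2
    simp_rw [mul_sub]
    rw [sum_sub_distrib, ← sum_mul]
    linarith [hjensen j, mul_le_mul_of_nonneg_left h1 hL]
  have hcost : (∑ t ∈ range T, α t) * (P.cost (P.estimate α K T i) - P.cost z) ≤
      ∑ t ∈ range T, α t * ((1 / (n : ℝ)) * ∑ j, (P.f j ((P.iter α K t).x j) - P.f j z)) +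
        P.L * D := by
    have h1 := mul_le_mul_of_nonneg_left (sum_le_sum fun j (_ : j ∈ univ) => hj j)
      (by positivity : 0 ≤ 1 / (n : ℝ))
    rw [← mul_sum, sum_sub_distrib, sum_add_distrib, sum_comm] at h1
    simp only [sum_const, card_univ, Fintype.card_fin, nsmul_eq_mul] at h1
    have e1 : 1 / (n : ℝ) * (n * (P.L * D)) = P.L * D := by field_simp
    rw [mul_add, e1, mul_sum] at h1
    have e2 : ∑ t ∈ range T, 1 / (n : ℝ) *
          ∑ j, α t * (P.f j ((P.iter α K t).x j) - P.f j z) =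
        ∑ t ∈ range T, α t * ((1 / (n : ℝ)) * ∑ j, (P.f j ((P.iter α K t).x j) - P.f j z)) :=
      sum_congr rfl fun t _ => by rw [← mul_sum]; ring
    rw [e2] at h1
    unfold cost
    linarith
  have := hP.sum_step_mul_gap_le K hη hα hαη hn hz T
  rw [hD] at hcost
  linarith

end Standing

end Problem

end DistPD

/-! ### The sampling noise: mean and exponential moments -/

namespace DistPD

open Finset

/-- Hoeffding's lemma for a finite law: `exp` lies below its chord on `[-b, b]`, whose mean is `cosh
b`. -/
theorem sum_mul_exp_le_exp_half_sq {ι : Type*} [Fintype ι] {p z : ι → ℝ} {b : ℝ}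
    (hp : ∀ k, 0 ≤ p k) (hp1 : ∑ k, p k = 1) (hz : ∑ k, p k * z k = 0) (hb : ∀ k, |z k| ≤ b) :
    ∑ k, p k * Real.exp (z k) ≤ Real.exp (b ^ 2 / 2) := by
  have h (k : ι) : Real.exp (z k) ≤ Real.cosh b + z k / b * Real.sinh b := by
    have hb0 : 0 ≤ b := (abs_nonneg _).trans (hb k)
    rcases hb0.eq_or_lt with h0 | h0
    · have : z k = 0 := abs_nonpos_iff.1 (by rw [h0]; exact hb k)
      simp [this, ← h0]
    · have h1 := Real.exp_mul_le_cosh_add_mul_sinh (t := z k / b)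
        (by rw [abs_div, abs_of_pos h0, div_le_one h0]; exact hb k) b
      rwa [div_mul_cancel₀ _ h0.ne'] at h1
  calc ∑ k, p k * Real.exp (z k)
      ≤ ∑ k, (p k * Real.cosh b + p k * z k * (Real.sinh b / b)) :=
        sum_le_sum fun k _ => (mul_le_mul_of_nonneg_left (h k) (hp k)).trans_eq (by ring)
    _ = Real.cosh b := by rw [sum_add_distrib, ← sum_mul, ← sum_mul, hp1, hz]; ring
    _ ≤ _ := Real.cosh_le_exp_half_sq b

variable {d n m : ℕ} {Ω : Type*}

/-- The indices drawn by all the agents before time `t`. -/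
def past (K : ℕ → Fin n → Ω → Fin m) (t : ℕ) (ω : Ω) : Fin t → Fin n → Fin m :=
  fun s j => K s j ω

theorem measurable_past_history (K : ℕ → Fin n → Ω → Fin m) (t : ℕ) :
    Measurable[history K t] (past K t) := by
  refine @measurable_pi_lambda _ _ _ (history K t) _ _ fun s => ?_
  refine @measurable_pi_lambda _ _ _ (history K t) _ _ fun j => ?_
  refine Measurable.of_comap_le ?_
  exact le_iSup_of_le (s : ℕ) (le_iSup_of_le s.2
    (le_iSup (fun j => MeasurableSpace.comap (K s j) inferInstance) j))

theorem exists_eq_comp_past {K : ℕ → Fin n → Ω → Fin m} {t : ℕ} {F : Ω → ℝ}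
    (hF : Function.FactorsThrough F (past K t)) :
    ∃ G : (Fin t → Fin n → Fin m) → ℝ, F = G ∘ past K t :=
  ⟨Function.extend (past K t) F fun _ => 0, (hF.extend_comp fun _ => 0).symm⟩

theorem measurable_of_factorsThrough_past {K : ℕ → Fin n → Ω → Fin m} {t : ℕ} {F : Ω → ℝ}
    (hF : Function.FactorsThrough F (past K t)) : Measurable[history K t] F := by
  obtain ⟨G, rfl⟩ := exists_eq_comp_past hF
  exact (measurable_of_countable G).comp (measurable_past_history K t)

theorem history_le [MeasurableSpace Ω] {K : ℕ → Fin n → Ω → Fin m}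
    (hK : ∀ t i, Measurable (K t i)) (t : ℕ) : history K t ≤ ‹MeasurableSpace Ω› :=
  iSup_le fun s => iSup_le fun _ => iSup_le fun j => (hK s j).comap_le

/-- The past takes finitely many values, so integrability needs no bound. -/
theorem integrable_of_factorsThrough_past [MeasurableSpace Ω] {μ : Measure Ω}
    [IsProbabilityMeasure μ] {K : ℕ → Fin n → Ω → Fin m} (hK : ∀ t i, Measurable (K t i)) {t : ℕ}
    {F : Ω → ℝ} (hF : Function.FactorsThrough F (past K t)) : Integrable F μ := by
  have hr : Measurable (past K t) := (measurable_past_history K t).mono (history_le hK t) le_rfl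
  obtain ⟨G, rfl⟩ := exists_eq_comp_past hF
  have : IsProbabilityMeasure (μ.map (past K t)) := Measure.isProbabilityMeasure_map hr.aemeasurable
  exact (Integrable.of_finite (μ := μ.map (past K t)) (f := G)).comp_measurable hr

theorem eq_of_past_eq {K : ℕ → Fin n → Ω → Fin m} {t s : ℕ} {ω ω' : Ω}
    (h : past K t ω = past K t ω') (hs : s < t) (j : Fin n) : K s j ω = K s j ω' :=
  congrFun (congrFun h ⟨s, hs⟩) j

namespace Problem

variable {P : Problem d n m} {α : ℕ → ℝ}

theorem iter_congr {K K' : ℕ → Fin n → Fin m} {t : ℕ} (h : ∀ s < t, ∀ j, K s j = K' s j) :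
    P.iter α K t = P.iter α K' t := by
  induction t with
  | zero => rfl
  | succ t ih =>
    rw [iter, iter, ih fun s hs => h s (by omega), funext (h t (by omega))]

theorem iter_eq_of_past_eq {K : ℕ → Fin n → Ω → Fin m} {t s : ℕ} {ω ω' : Ω}
    (h : past K t ω = past K t ω') (hs : s ≤ t) :
    P.iter α (fun r j => K r j ω) s = P.iter α (fun r j => K r j ω') s :=
  iter_congr fun _ hr j => eq_of_past_eq h (by omega) j

variable [MeasurableSpace Ω] {μ : Measure Ω} [IsProbabilityMeasure μ]
  {K : ℕ → Fin n → Ω → Fin m}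

/-- Split over the value drawn and pull the factor known from the past out of the conditional
expectation of the indicator. -/
theorem IsSampling.integral_apply (hK : P.IsSampling μ α K) (t : ℕ) (i : Fin n)
    {φ : Ω → Fin m → ℝ} (hφ : ∀ k, Function.FactorsThrough (fun ω => φ ω k) (past K t)) :
    ∫ ω, φ ω (K t i ω) ∂μ =
      ∫ ω, ∑ k, samplingProb ((P.iter α (fun s j => K s j ω) t).lam i) k * φ ω k ∂μ := by
  have hle := history_le hK.measurable t
  have hset (k : Fin m) : MeasurableSet (K t i ⁻¹' {k}) := hK.measurable t i (measurableSet_singleton k)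
  have hdecomp : (fun ω => φ ω (K t i ω)) =
      fun ω => ∑ k, φ ω k * (K t i ⁻¹' {k}).indicator (fun _ => (1 : ℝ)) ω := by
    funext ω
    rw [sum_eq_single (K t i ω)]
    · simp
    · intro k _ hk
      rw [Set.indicator_of_notMem (by simpa using hk.symm), mul_zero]
    · simp
  have hind (k : Fin m) : Integrable ((K t i ⁻¹' {k}).indicator fun _ => (1 : ℝ)) μ :=
    (integrable_const 1).indicator (hset k)
  have hint (k : Fin m) : Integrable
      (fun ω => φ ω k * (K t i ⁻¹' {k}).indicator (fun _ => (1 : ℝ)) ω) μ := by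
    have h1 := (integrable_of_factorsThrough_past (μ := μ) hK.measurable (hφ k)).indicator (hset k)
    refine h1.congr (Filter.Eventually.of_forall fun ω => ?_)
    by_cases hω : ω ∈ K t i ⁻¹' {k} <;> simp [Set.indicator, hω]
  have hint' (k : Fin m) : Integrable
      (fun ω => samplingProb ((P.iter α (fun s j => K s j ω) t).lam i) k * φ ω k) μ := by
    refine integrable_of_factorsThrough_past (t := t) hK.measurable fun ω ω' h => ?_
    have h1 := hφ k h
    simp only at h1 ⊢
    rw [h1, iter_eq_of_past_eq h le_rfl]
  rw [hdecomp, integral_finsetSum _ fun k _ => hint k, integral_finsetSum _ fun k _ => hint' k]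
  refine sum_congr rfl fun k _ => ?_
  have hpull := condExp_mul_of_stronglyMeasurable_left (μ := μ) (m := history K t)
    (measurable_of_factorsThrough_past (hφ k)).stronglyMeasurable (hint k) (hind k)
  rw [← integral_condExp hle]
  refine integral_congr_ae ?_
  filter_upwards [hpull, hK.cond_law t i k] with ω h1 h2
  refine h1.trans ?_
  rw [Pi.mul_apply, h2, mul_comm]

namespace Standing

variable (hP : P.Standing) (hK : P.IsSampling μ α K) {z : EuclideanSpace ℝ (Fin d)}

theorem sum_samplingProb_mul_noise (hm : 0 < m) (K : ℕ → Fin n → Fin m) (t : ℕ) (j : Fin n) :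
    ∑ k, samplingProb ((P.iter α K t).lam j) k * P.noise z (P.iter α K t) j k = 0 := by
  have h1 := sum_samplingProb hm (iter_lam_nonneg (P := P) (α := α) K t j)
  simp_rw [noise, mul_sub]
  rw [sum_sub_distrib, ← sum_mul, h1, one_mul, sub_self]

include hK in
theorem integral_noise (t : ℕ) (j : Fin n) :
    ∫ ω, P.noise z (P.iter α (fun s j => K s j ω) t) j (K t j ω) ∂μ = 0 := by
  rw [hK.integral_apply t j (φ := fun ω k => P.noise z (P.iter α (fun s j => K s j ω) t) j k)
    fun k ω ω' h => by simp only; rw [iter_eq_of_past_eq h le_rfl]]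
  simp_rw [fun ω => sum_samplingProb_mul_noise (P := P) (α := α) (K t j ω).pos
    (fun s j => K s j ω) (z := z) t j]
  exact integral_zero Ω ℝ

/-- The accumulated sampling error, averaged over the agents. -/
noncomputable def _root_.DistPD.Problem.totalNoise (P : Problem d n m)
    (z : EuclideanSpace ℝ (Fin d)) (α : ℕ → ℝ) (K : ℕ → Fin n → Fin m) (T : ℕ) : ℝ :=
  ∑ t ∈ range T, α t * ((1 / (n : ℝ)) * ∑ j, P.noise z (P.iter α K t) j (K t j))

omit [MeasurableSpace Ω] in
theorem totalNoise_eq_of_past_eq {T : ℕ} {ω ω' : Ω} (h : past K T ω = past K T ω') :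
    P.totalNoise z α (fun s j => K s j ω) T = P.totalNoise z α (fun s j => K s j ω') T := by
  refine sum_congr rfl fun t ht => ?_
  have ht' := mem_range.1 ht
  rw [iter_eq_of_past_eq h ht'.le]
  simp_rw [eq_of_past_eq h ht']

include hK in
theorem integral_totalNoise (T : ℕ) :
    ∫ ω, P.totalNoise z α (fun s j => K s j ω) T ∂μ = 0 := by
  have hint (t : ℕ) (j : Fin n) :
      Integrable (fun ω => P.noise z (P.iter α (fun s j => K s j ω) t) j (K t j ω)) μ :=
    integrable_of_factorsThrough_past (t := t + 1) hK.measurable fun ω ω' h => by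
      rw [iter_eq_of_past_eq h (Nat.le_succ t), eq_of_past_eq h (Nat.lt_succ_self t)]
  unfold totalNoise
  rw [integral_finsetSum _ fun t _ =>
    ((integrable_finsetSum _ fun j _ => hint t j).const_mul _).const_mul _]
  refine sum_eq_zero fun t _ => ?_
  rw [integral_const_mul, integral_const_mul, integral_finsetSum _ fun j _ => hint t j,
    sum_eq_zero fun j _ => integral_noise hK t j, mul_zero, mul_zero]

include hP hK in
theorem integral_exp_totalNoise_le (hn : 2 ≤ n) (hη : 0 < P.η) (hα : ∀ t, 0 ≤ α t)
    (hαη : ∀ t, P.η * α t ≤ 1 / 2) (hz : z ∈ P.ball) (s : ℝ) (T : ℕ) :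
    ∫ ω, Real.exp (s * P.totalNoise z α (fun s j => K s j ω) T) ∂μ ≤
      Real.exp (s ^ 2 * (8 * m * P.L ^ 2 * P.R ^ 2 / P.η) ^ 2 / 2 * ∑ t ∈ range T, α t ^ 2) := by
  set B := 8 * m * P.L ^ 2 * P.R ^ 2 / P.η with hB
  have hL := hP.L_nonneg (by omega)
  have hn0 : (n : ℝ) ≠ 0 := by positivity
  induction T with
  | zero => simp [totalNoise]
  | succ T ih =>
    set E : Ω → ℝ := fun ω => Real.exp (s * P.totalNoise z α (fun s j => K s j ω) T) with hE
    set ξ : Ω → Fin n → Fin m → ℝ := fun ω j k =>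
      P.noise z (P.iter α (fun s j => K s j ω) T) j k with hξ
    have hEF : Function.FactorsThrough E (past K T) := fun ω ω' h => by
      simp only [hE]; rw [totalNoise_eq_of_past_eq h]
    have hEint : Integrable E μ := integrable_of_factorsThrough_past hK.measurable hEF
    have hξF {ω ω' : Ω} (h : past K T ω = past K T ω') : ξ ω = ξ ω' := by
      simp only [hξ]; rw [iter_eq_of_past_eq h le_rfl]
    have hFF (j : Fin n) (k : Fin m) : Function.FactorsThrough
        (fun ω => E ω * Real.exp (s * α T * ξ ω j k)) (past K T) := fun ω ω' h => by
      simp only; rw [hEF h, hξF h]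
    have hbound (j : Fin n) (ω : Ω) :
        ∑ k, samplingProb ((P.iter α (fun s j => K s j ω) T).lam j) k *
          (E ω * Real.exp (s * α T * ξ ω j k)) ≤ E ω * Real.exp ((s * α T * B) ^ 2 / 2) := by
      have hlam := iter_lam_nonneg (P := P) (α := α) (fun s j => K s j ω) T j
      have hp1 := sum_samplingProb (K T j ω).pos hlam
      have h1 := sum_mul_exp_le_exp_half_sq (z := fun k => s * α T * ξ ω j k)
        (b := |s * α T| * B) (samplingProb_nonneg hlam) hp1 ?_ ?_
      · rw [mul_pow, sq_abs, ← mul_pow] at h1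
        refine le_trans (le_of_eq ?_) (mul_le_mul_of_nonneg_left h1 (Real.exp_pos _).le)
        rw [mul_sum]
        exact sum_congr rfl fun k _ => by ring
      · simp_rw [mul_left_comm _ (s * α T), ← mul_sum]
        rw [sum_samplingProb_mul_noise (K T j ω).pos (fun s j => K s j ω) T j, mul_zero]
      · intro k
        rw [abs_mul]
        exact mul_le_mul_of_nonneg_left
          (hP.abs_noise_le (fun s j => K s j ω) hη hα hαη hz hL T j k) (abs_nonneg _)
    have hint (j : Fin n) : Integrable (fun ω => E ω * Real.exp (s * α T * ξ ω j (K T j ω))) μ :=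
      integrable_of_factorsThrough_past (t := T + 1) hK.measurable fun ω ω' h => by
        have h' : past K T ω = past K T ω' := funext fun r => funext fun j =>
          eq_of_past_eq h (by omega) j
        rw [hEF h', hξF h', eq_of_past_eq h (Nat.lt_succ_self T)]
    have hagent (j : Fin n) : ∫ ω, E ω * Real.exp (s * α T * ξ ω j (K T j ω)) ∂μ ≤
        (∫ ω, E ω ∂μ) * Real.exp ((s * α T * B) ^ 2 / 2) := by
      rw [hK.integral_apply T j (φ := fun ω k => E ω * Real.exp (s * α T * ξ ω j k)) (hFF j),
        ← integral_mul_const]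
      refine integral_mono (integrable_of_factorsThrough_past (t := T) hK.measurable
        fun ω ω' h => ?_) (hEint.mul_const _) (hbound j)
      rw [hEF h, hξF h, iter_eq_of_past_eq h le_rfl]
    -- Only the conditional law of each single draw is prescribed, not the joint law across agents.
    -- Convexity of `exp` reduces the average over the agents to one agent at a time, with no
    -- independence.
    have hconv (ω : Ω) : Real.exp (s * P.totalNoise z α (fun s j => K s j ω) (T + 1)) ≤
        ∑ j, (1 / (n : ℝ)) * (E ω * Real.exp (s * α T * ξ ω j (K T j ω))) := by
      have h1 := convexOn_exp.map_sum_le (t := univ) (w := fun _ : Fin n => 1 / (n : ℝ))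
        (p := fun j => s * α T * ξ ω j (K T j ω)) (fun _ _ => by positivity) (by simp [hn0])
        (fun _ _ => Set.mem_univ _)
      simp only [smul_eq_mul] at h1
      have h2 : s * P.totalNoise z α (fun s j => K s j ω) (T + 1) =
          s * P.totalNoise z α (fun s j => K s j ω) T +
            ∑ j, 1 / (n : ℝ) * (s * α T * ξ ω j (K T j ω)) := by
        rw [totalNoise, sum_range_succ, ← totalNoise, ← mul_sum, ← mul_sum]
        ring
      rw [h2, Real.exp_add]
      refine (mul_le_mul_of_nonneg_left h1 (Real.exp_pos _).le).trans_eq ?_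
      rw [mul_sum]
      exact sum_congr rfl fun j _ => by simp only [hE]; ring
    calc ∫ ω, Real.exp (s * P.totalNoise z α (fun s j => K s j ω) (T + 1)) ∂μ
        ≤ ∫ ω, ∑ j, (1 / (n : ℝ)) * (E ω * Real.exp (s * α T * ξ ω j (K T j ω))) ∂μ := by
          refine integral_mono (integrable_of_factorsThrough_past (t := T + 1) hK.measurable
            fun ω ω' h => ?_) (integrable_finsetSum _ fun j _ => (hint j).const_mul _) hconv
          rw [totalNoise_eq_of_past_eq h]
      _ ≤ ∑ j : Fin n, (1 / (n : ℝ)) * ((∫ ω, E ω ∂μ) * Real.exp ((s * α T * B) ^ 2 / 2)) := by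
          rw [integral_finsetSum _ fun j _ => (hint j).const_mul _]
          refine sum_le_sum fun j _ => ?_
          rw [integral_const_mul]
          exact mul_le_mul_of_nonneg_left (hagent j) (by positivity)
      _ = (∫ ω, E ω ∂μ) * Real.exp ((s * α T * B) ^ 2 / 2) := by
          simp [← mul_assoc, hn0]
      _ ≤ _ := by
          refine (mul_le_mul_of_nonneg_right ih (Real.exp_pos _).le).trans_eq ?_
          rw [← Real.exp_add, sum_range_succ]
          congr 1
          ring

include hP hK in
theorem measure_totalNoise_ge_le (hn : 2 ≤ n) (hη : 0 < P.η) (hα : ∀ t, 0 ≤ α t)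
    (hαη : ∀ t, P.η * α t ≤ 1 / 2) (hz : z ∈ P.ball) {s : ℝ} (hs : 0 ≤ s) (T : ℕ) (ε : ℝ) :
    μ.real {ω | ε ≤ P.totalNoise z α (fun s j => K s j ω) T} ≤
      Real.exp (-s * ε +
        s ^ 2 * (8 * m * P.L ^ 2 * P.R ^ 2 / P.η) ^ 2 / 2 * ∑ t ∈ range T, α t ^ 2) := by
  have h := measure_ge_le_exp_mul_mgf (μ := μ) (t := s)
    (X := fun ω => P.totalNoise z α (fun s j => K s j ω) T) ε hs
    (integrable_of_factorsThrough_past (t := T) hK.measurable fun ω ω' h => by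
      rw [totalNoise_eq_of_past_eq h])
  refine h.trans ?_
  rw [Real.exp_add]
  exact mul_le_mul_of_nonneg_left
    (hP.integral_exp_totalNoise_le hK hn hη hα hαη hz s T) (Real.exp_pos _).le

end Standing

end Problem

end DistPD

/-! ### Numerical constants for the step size `R / √(t + 1)` -/

namespace DistPD

open Finset

/-- The right side is `log √n + (3/2) log T`, and `(3/2) log 2 > 1`. -/
theorem log_mul_sqrt_ge {n T : ℕ} (hn : 2 ≤ n) (hT : 2 ≤ T) :
    Real.log √(n : ℝ) + 1 ≤ Real.log ((T : ℝ) * √((n : ℝ) * T)) := by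
  have hT0 : (0 : ℝ) < T := by positivity
  have hn0 : (0 : ℝ) < n := by positivity
  have hT2 : Real.log 2 ≤ Real.log T :=
    Real.log_le_log (by norm_num) (by exact_mod_cast hT)
  rw [Real.log_mul hT0.ne' (by positivity), Real.log_sqrt (by positivity),
    Real.log_sqrt (by positivity), Real.log_mul hn0.ne' hT0.ne']
  linarith [Real.log_two_gt_d9]

namespace Problem

variable {d n m : ℕ} {P : Problem d n m}

namespace Standing

variable (hP : P.Standing)
include hP

theorem stepsize_nonneg (t : ℕ) : 0 ≤ P.stepsize t :=
  div_nonneg hP.radius_pos.le (Real.sqrt_nonneg _)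

omit hP in
theorem sum_stepsize (T : ℕ) :
    ∑ t ∈ range T, P.stepsize t = P.R * ∑ t ∈ range T, 1 / √((t : ℝ) + 1) := by
  rw [mul_sum]
  exact sum_congr rfl fun t _ => by rw [stepsize, mul_one_div]

omit hP in
theorem sum_stepsize_sq (T : ℕ) :
    ∑ t ∈ range T, P.stepsize t ^ 2 = P.R ^ 2 * ∑ t ∈ range T, 1 / ((t : ℝ) + 1) := by
  rw [mul_sum]
  refine sum_congr rfl fun t _ => ?_
  rw [stepsize, div_pow, Real.sq_sqrt (by positivity), mul_one_div]

theorem gradBound_ge (hn : 2 ≤ n) (hm : 0 < m) (hη : 0 < P.η) :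
    P.L ≤ P.gradBound ∧ 8 * m * P.L ^ 2 * P.R ^ 2 / P.η ≤ 4 * P.R * P.gradBound := by
  have hL := hP.L_nonneg (by omega)
  have hR := hP.radius_pos
  have hm1 : (1 : ℝ) ≤ m := by exact_mod_cast hm
  have hn2 : (2 : ℝ) ≤ n := by exact_mod_cast hn
  have hmp : (m : ℝ) ≤ (m : ℝ) ^ ((3 : ℝ) / 2) := by
    simpa using Real.rpow_le_rpow_of_exponent_le hm1 (by norm_num : (1 : ℝ) ≤ 3 / 2)
  have h1 : 2 * m * P.L * P.R / P.η ≤ (n : ℝ) * (m : ℝ) ^ ((3 : ℝ) / 2) * P.L * P.R / P.η := by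
    gcongr
  have h0 : 0 ≤ 2 * m * P.L * P.R / P.η := by positivity
  have h2 := mul_le_mul_of_nonneg_left h1 hL
  have h3 : 0 ≤ P.L * (2 * m * P.L * P.R / P.η) := by positivity
  unfold gradBound
  refine ⟨by linarith, ?_⟩
  calc 8 * m * P.L ^ 2 * P.R ^ 2 / P.η = 4 * P.R * (P.L * (2 * m * P.L * P.R / P.η)) := by ring
    _ ≤ _ := mul_le_mul_of_nonneg_left (by linarith) (by positivity)

omit hP in
theorem rateConst_eq (T : ℕ) : P.rateConst T = 1 + 5 / 2 * m * P.L ^ 2 * P.R ^ 2 +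
    20 * P.gradBound ^ 2 *
      (Real.log ((T : ℝ) * √((n : ℝ) * T)) / (1 - P.sigma2)) ^ ((3 : ℝ) / 2) := by
  rw [rateConst, gradBound]; ring

omit hP in
theorem mixing_le_rpow (hn : 2 ≤ n) (hσ : P.sigma2 < 1) {T : ℕ} (hT : 2 ≤ T) :
    1 ≤ (Real.log ((T : ℝ) * √((n : ℝ) * T)) / (1 - P.sigma2)) ^ ((3 : ℝ) / 2) ∧
      (2 * Real.log √(n : ℝ) + 3) / (1 - P.sigma2) ≤
        3 * (Real.log ((T : ℝ) * √((n : ℝ) * T)) / (1 - P.sigma2)) ^ ((3 : ℝ) / 2) := by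
  have hσ0 : 0 ≤ P.sigma2 := LinearMap.singularValues_nonneg _ 1
  have hσ' : 0 < 1 - P.sigma2 := by linarith
  have hl := log_mul_sqrt_ge hn hT
  have hl0 : 0 ≤ Real.log √(n : ℝ) :=
    Real.log_nonneg (Real.one_le_sqrt.2 (by exact_mod_cast (by omega : 1 ≤ n)))
  set l := Real.log ((T : ℝ) * √((n : ℝ) * T))
  have hS : 1 ≤ l / (1 - P.sigma2) := by rw [le_div_iff₀ hσ']; linarith
  have hSZ : l / (1 - P.sigma2) ≤ (l / (1 - P.sigma2)) ^ ((3 : ℝ) / 2) := by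
    simpa using Real.rpow_le_rpow_of_exponent_le hS (by norm_num : (1 : ℝ) ≤ 3 / 2)
  refine ⟨hS.trans hSZ, le_trans ?_ (mul_le_mul_of_nonneg_left hSZ (by norm_num))⟩
  rw [← mul_div_assoc]
  gcongr
  linarith

theorem sum_stepsize_mul_cost_sub_le (hn : 2 ≤ n) (hη : 0 < P.η) (hσ : P.sigma2 < 1)
    (hstep : ∀ t, P.η * P.stepsize t ≤ 1 / 2) {z : EuclideanSpace ℝ (Fin d)}
    (hz : z ∈ P.feasible) {T : ℕ} (hT : 2 ≤ T) (K : ℕ → Fin n → Fin m) (i : Fin n) :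
    (∑ t ∈ range T, P.stepsize t) * (P.cost (P.estimate P.stepsize K T i) - P.cost z) ≤
      (∑ t ∈ range T, P.stepsize t) * (P.R * (Real.log T / (√(T : ℝ) - 1)) *
        (3 / 8 + 5 / 2 * m * P.L ^ 2 * P.R ^ 2 + 7 * P.gradBound ^ 2 *
          (Real.log ((T : ℝ) * √((n : ℝ) * T)) / (1 - P.sigma2)) ^ ((3 : ℝ) / 2))) +
        P.totalNoise z P.stepsize K T := by
  have hR := hP.radius_pos
  have hL := hP.L_nonneg (by omega)
  have hm : 0 < m := (K 0 ⟨0, by omega⟩).pos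
  obtain ⟨hLG, -⟩ := hP.gradBound_ge hn hm hη
  obtain ⟨hZ1, hMZ⟩ := mixing_le_rpow hn hσ hT
  set Z := (Real.log ((T : ℝ) * √((n : ℝ) * T)) / (1 - P.sigma2)) ^ ((3 : ℝ) / 2)
  set G := P.gradBound
  have hpos : 0 < ∑ t ∈ range T, P.stepsize t :=
    sum_pos (fun t _ => div_pos hR (by positivity)) ⟨0, by simp; omega⟩
  have hdet := hP.sum_step_mul_cost_sub_le K hη hP.stepsize_nonneg hstep hn hσ hz hpos i
  rw [← totalNoise, sum_stepsize_sq] at hdet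
  set M := (2 * Real.log √(n : ℝ) + 3) / (1 - P.sigma2)
  have hsqrt : 1 < √(T : ℝ) := Real.lt_sqrt_of_sq_lt (by
    have : (2 : ℝ) ≤ T := by exact_mod_cast hT
    linarith)
  have hH := harmonic_mul_le hT
  have hQ := two_mul_sqrt_sub_one_le_sum T
  have hlog : Real.log 2 ≤ Real.log T := Real.log_le_log (by norm_num) (by exact_mod_cast hT)
  have hlog2 := Real.log_two_gt_d9
  have hH0 : 0 ≤ ∑ t ∈ range T, 1 / ((t : ℝ) + 1) := sum_nonneg fun t _ => by positivity
  rw [sum_stepsize] at hdet ⊢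
  set H := ∑ t ∈ range T, 1 / ((t : ℝ) + 1)
  set Q := ∑ t ∈ range T, 1 / √((t : ℝ) + 1)
  set ρ := Real.log T / (√(T : ℝ) - 1) with hρ
  have hs0 : 0 < √(T : ℝ) - 1 := by linarith
  have hHρ : H ≤ 15 / 16 * (ρ * Q) := by
    have : 15 / 16 * (ρ * Q) = 15 / 16 * Real.log T * Q / (√(T : ℝ) - 1) := by rw [hρ]; ring
    rw [this, le_div_iff₀ hs0]
    exact hH
  -- Since `Q ≥ 2(√T - 1)`, the product `ρ * Q` is at least `2 log 2 > 4/3`.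
  have hQρ : 1 / 2 ≤ 3 / 8 * (ρ * Q) := by
    have : 3 / 8 * (ρ * Q) = 3 / 8 * Real.log T * Q / (√(T : ℝ) - 1) := by rw [hρ]; ring
    rw [this, le_div_iff₀ hs0]
    nlinarith
  have hG0 : 0 ≤ G := hL.trans hLG
  have hbr : G ^ 2 / 2 + 8 / 3 * m * P.L ^ 2 * P.R ^ 2 + 2 * P.L * G * M ≤
      13 / 2 * (G ^ 2 * Z) + 8 / 3 * m * P.L ^ 2 * P.R ^ 2 := by
    have h1 : 2 * P.L * G * M ≤ 2 * P.L * G * (3 * Z) :=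
      mul_le_mul_of_nonneg_left hMZ (by positivity)
    have h2 : 2 * P.L * G * (3 * Z) ≤ 2 * G * G * (3 * Z) := by gcongr
    have h3 : G ^ 2 ≤ G ^ 2 * Z := le_mul_of_one_le_right (by positivity) hZ1
    linarith
  have hGZ : 0 ≤ G ^ 2 * Z := by positivity
  have hmain : H * (G ^ 2 / 2 + 8 / 3 * m * P.L ^ 2 * P.R ^ 2 + 2 * P.L * G * M) ≤
      15 / 16 * (ρ * Q) * (13 / 2 * (G ^ 2 * Z) + 8 / 3 * m * P.L ^ 2 * P.R ^ 2) :=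
    (mul_le_mul_of_nonneg_left hbr hH0).trans
      (mul_le_mul_of_nonneg_right hHρ (by positivity))
  have hρQ : 0 ≤ ρ * Q := by linarith
  have h4 := mul_le_mul_of_nonneg_left (add_le_add hQρ hmain) (sq_nonneg P.R)
  have h5 : 0 ≤ P.R ^ 2 * ((ρ * Q) * (G ^ 2 * Z)) := by positivity
  linarith

end Standing

end Problem

end DistPD

/-! ### The convergence theorem -/

open Finset DistPD DistPD.Problem DistPD.Problem.Standing in
theorem theorem3 {d n m : ℕ} (hn : 2 ≤ n) (P : DistPD.Problem d n m) (hP : P.Standing)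
    (hgap : P.sigma2 < 1) (hη : 0 < P.η) (hstep : ∀ t : ℕ, P.η * P.stepsize t ≤ 1 / 2)
    {Ω : Type*} [MeasurableSpace Ω] (μ : Measure Ω) [IsProbabilityMeasure μ]
    (K : ℕ → Fin n → Ω → Fin m) (hK : P.IsSampling μ P.stepsize K)
    (xstar : EuclideanSpace ℝ (Fin d)) (hxstar : xstar ∈ P.feasible)
    (hmin : IsMinOn P.cost P.feasible xstar) (T : ℕ) (hT : 2 ≤ T) :
    (1 - 1 / (T : ℝ) ≤ μ.real {ω | ∀ i : Fin n,
        P.cost (P.estimate P.stepsize (fun s j => K s j ω) T i) - P.cost xstar ≤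
          Real.log T / (√(T : ℝ) - 1) *
            (P.R * P.rateConst T +
              4 * √10 * (n : ℝ) * (m : ℝ) ^ 2 * P.L ^ 2 * P.R ^ 3 / P.η)}) ∧
    ∀ i : Fin n,
      Integrable (fun ω =>
        P.cost (P.estimate P.stepsize (fun s j => K s j ω) T i) - P.cost xstar) μ ∧
      ∫ ω, (P.cost (P.estimate P.stepsize (fun s j => K s j ω) T i) - P.cost xstar) ∂μ ≤
        P.R * P.rateConst T * Real.log T / (√(T : ℝ) - 1) := by
  have hR := hP.radius_pos
  have hL := hP.L_nonneg (by omega)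
  obtain ⟨ω₀⟩ : Nonempty Ω := nonempty_of_isProbabilityMeasure μ
  have hm : 0 < m := (K 0 ⟨0, by omega⟩ ω₀).pos
  obtain ⟨-, hB⟩ := hP.gradBound_ge hn hm hη
  obtain ⟨hZ1, -⟩ := mixing_le_rpow (P := P) hn hgap hT
  have hdet (i : Fin n) (ω : Ω) := hP.sum_stepsize_mul_cost_sub_le hn hη hgap hstep hxstar hT
    (fun s j => K s j ω) i
  rw [rateConst_eq]
  set Z := (Real.log ((T : ℝ) * √((n : ℝ) * T)) / (1 - P.sigma2)) ^ ((3 : ℝ) / 2)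
  set G := P.gradBound
  set N : Ω → ℝ := fun ω => P.totalNoise xstar P.stepsize (fun s j => K s j ω) T with hN
  have hT0 : (0 : ℝ) < T := by positivity
  have hsqrt : 1 < √(T : ℝ) := Real.lt_sqrt_of_sq_lt (by
    have : (2 : ℝ) ≤ T := by exact_mod_cast hT
    linarith)
  have hs0 : 0 < √(T : ℝ) - 1 := by linarith
  have hlog0 : 0 ≤ Real.log T := Real.log_natCast_nonneg T
  set ρ := Real.log T / (√(T : ℝ) - 1) with hρ
  have hρ0 : 0 ≤ ρ := div_nonneg hlog0 hs0.le
  set w := ∑ t ∈ range T, P.stepsize t with hw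
  have hw0 : 0 < w := sum_pos (fun t _ => div_pos hR (by positivity)) ⟨0, by simp; omega⟩
  have hgapN (i : Fin n) (ω : Ω) :
      P.cost (P.estimate P.stepsize (fun s j => K s j ω) T i) - P.cost xstar ≤
        P.R * ρ * (3 / 8 + 5 / 2 * m * P.L ^ 2 * P.R ^ 2 + 7 * G ^ 2 * Z) + N ω / w := by
    rw [← sub_le_iff_le_add', le_div_iff₀ hw0]
    linarith [hdet i ω]
  constructor
  · set H := ∑ t ∈ range T, 1 / ((t : ℝ) + 1) with hH
    set B := 8 * m * P.L ^ 2 * P.R ^ 2 / P.η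
    -- With Chernoff parameter `1 / R²`, the second term cancels the variance term and the first
    -- leaves exactly `-log T` in the exponent.
    set ε := P.R ^ 2 * Real.log T + B ^ 2 / 2 * H with hε
    have htail : μ.real {ω | ε ≤ N ω} ≤ 1 / T := by
      refine (hP.measure_totalNoise_ge_le hK hn hη hP.stepsize_nonneg hstep
        (hP.feasible_subset hxstar) (s := 1 / P.R ^ 2) (by positivity) T ε).trans_eq ?_
      have h1 : -(1 / P.R ^ 2) * ε + (1 / P.R ^ 2) ^ 2 * B ^ 2 / 2 *
          ∑ t ∈ range T, P.stepsize t ^ 2 = -Real.log T := by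
        rw [sum_stepsize_sq, hε, ← hH]
        field_simp
        ring
      rw [h1, Real.exp_neg, Real.exp_log hT0, one_div]
    have hεw : ε / w ≤ P.R * ρ * (1 / 2 + 15 / 2 * G ^ 2) := by
      rw [div_le_iff₀ hw0, hw, sum_stepsize]
      have hHQ := harmonic_mul_le hT
      have hQ := two_mul_sqrt_sub_one_le_sum T
      have hH0 : 0 ≤ H := sum_nonneg fun t _ => by positivity
      have hB0 : 0 ≤ B := by positivity
      have hB2 : B ^ 2 ≤ 16 * (P.R ^ 2 * G ^ 2) :=
        (pow_le_pow_left₀ hB0 hB 2).trans_eq (by ring)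
      rw [← hH] at hHQ
      set Q := ∑ t ∈ range T, 1 / √((t : ℝ) + 1)
      have hHρ : H ≤ 15 / 16 * (ρ * Q) := by
        have : 15 / 16 * (ρ * Q) = 15 / 16 * Real.log T * Q / (√(T : ℝ) - 1) := by rw [hρ]; ring
        rw [this, le_div_iff₀ hs0]
        exact hHQ
      have hlogρ : Real.log T ≤ 1 / 2 * (ρ * Q) := by
        have : Real.log T = ρ * (√(T : ℝ) - 1) := (div_mul_cancel₀ _ hs0.ne').symm
        rw [this]
        linarith [mul_le_mul_of_nonneg_left hQ hρ0]
      have h1 : B ^ 2 / 2 * H ≤ 16 * (P.R ^ 2 * G ^ 2) / 2 * (15 / 16 * (ρ * Q)) := by gcongr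
      have h2 := mul_le_mul_of_nonneg_left hlogρ (sq_nonneg P.R)
      rw [hε]
      linarith
    -- `N` does not depend on the agent, so one exceptional event serves all of them. The deviation
    -- fits into the slack of the constants (`3/8 + 1/2 ≤ 1` and `7 + 15/2 ≤ 20`); of the term with
    -- `√10` only the sign matters.
    have hcover : Set.univ ⊆ {ω | ∀ i : Fin n,
        P.cost (P.estimate P.stepsize (fun s j => K s j ω) T i) - P.cost xstar ≤
          ρ * (P.R * (1 + 5 / 2 * m * P.L ^ 2 * P.R ^ 2 + 20 * G ^ 2 * Z) +
            4 * √10 * (n : ℝ) * (m : ℝ) ^ 2 * P.L ^ 2 * P.R ^ 3 / P.η)} ∪ {ω | ε ≤ N ω} := by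
      intro ω _
      refine (le_or_gt ε (N ω)).symm.imp (fun hlt i => (hgapN i ω).trans ?_) id
      have h1 : N ω / w ≤ ε / w := by gcongr
      have h2 : 0 ≤ ρ * (4 * √10 * (n : ℝ) * (m : ℝ) ^ 2 * P.L ^ 2 * P.R ^ 3 / P.η) := by
        positivity
      have hRρ : 0 ≤ P.R * ρ := by positivity
      have h3 : G ^ 2 ≤ G ^ 2 * Z := le_mul_of_one_le_right (by positivity) hZ1
      have h4 := mul_le_mul_of_nonneg_left h3 hRρ
      have h5 : 0 ≤ P.R * ρ * (G ^ 2 * Z) := by positivity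
      linarith
    have h1 := (measureReal_mono (μ := μ) hcover).trans (measureReal_union_le _ _)
    rw [probReal_univ] at h1
    linarith
  · intro i
    have hNint : Integrable N μ := integrable_of_factorsThrough_past (t := T) hK.measurable
      fun ω ω' h => totalNoise_eq_of_past_eq h
    have hint : Integrable (fun ω =>
        P.cost (P.estimate P.stepsize (fun s j => K s j ω) T i) - P.cost xstar) μ := by
      refine integrable_of_factorsThrough_past (t := T) hK.measurable fun ω ω' h => ?_
      have h1 : P.estimate P.stepsize (fun s j => K s j ω) T i =
          P.estimate P.stepsize (fun s j => K s j ω') T i := by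
        unfold estimate
        congr 1
        exact sum_congr rfl fun t ht => by rw [iter_eq_of_past_eq h (mem_range.1 ht).le]
      simp only [h1]
    refine ⟨hint, ?_⟩
    have h1 := integral_mono hint ((integrable_const _).add (hNint.div_const w)) (hgapN i)
    refine h1.trans ?_
    simp only [Pi.add_apply]
    rw [integral_add (integrable_const _) (hNint.div_const w), integral_div, hN,
      integral_totalNoise hK T, zero_div, add_zero, integral_const, probReal_univ, one_smul]
    have h2 : P.R * (1 + 5 / 2 * m * P.L ^ 2 * P.R ^ 2 + 20 * G ^ 2 * Z) * Real.log T /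
        (√(T : ℝ) - 1) =
        P.R * ρ * (1 + 5 / 2 * m * P.L ^ 2 * P.R ^ 2 + 20 * G ^ 2 * Z) := by rw [hρ]; ring
    rw [h2]
    refine mul_le_mul_of_nonneg_left ?_ (by positivity)
    have h3 : 0 ≤ G ^ 2 * Z := by positivity
    linarith
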